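/- \textbf{Setting.} Let $N\ge 2$ and let $[x_k]=(x_0,\dots,x_N)$ be a zero-mean nonsingular Gaussian sequence of random vectors in $\mathbb{R}^d$, i.e. $(x_0,\dots,x_N)$ is jointly Gaussian, has mean zero, and the covariance matrix of the whole sequence is positive definite. The sequence is \emph{Markov} if for every $k$ the subsequences $(x_i)_{i<k}$ and $(x_i)_{i>k}$ are conditionally independent given $x_k$; it is \emph{reciprocal} if for all $k_1<k_2$ the subsequences $(x_i)_{k_1<i<k_2}$ and $(x_i)_{i<k_1\text{ or }i>k_2}$ are conditionally independent given $(x_{k_1},x_{k_2})$. A prime denotes transposition. Let $c\in\{0,N\}$. The sequence is governed by the \emph{forward $CM_c$ model} with $d\times d$ coefficient matrices $G_{k,j}$ and noise covariances $G_k$ if there is a zero-mean white (jointly Gaussian, uncorrelated over time) Gaussian sequence $(e_k)_{k=0}^N$ with nonsingular covariance matrices $G_k=\operatorname{Cov}(e_k)$ such that, almost surely, $$x_k=G_{k,k-1}x_{k-1}+G_{k,c}x_c+e_k,\qquad k\in\{1,\dots,N\}\setminus\{c\},\tag{1}$$ (for $c=0$, $k=1$ both coefficients are $G_{1,0}$),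 together with one of the following boundary conditions: $$x_0=e_0,\quad\text{and, for } c=N,\quad x_N=G_{N,0}x_0+e_N;\tag{2}$$ $$x_c=e_c,\quad\text{and, for } c=N,\quad x_0=G_{0,N}x_N+e_0.\tag{3}$$ (The noise $(e_k)$ and the parameters may differ between (2) and (3); for $c=0$ both read $x_0=e_0$.) \textbf{Theorem.} For each $c\in\{0,N\}$ and each choice of boundary condition, (2) or (3): (i) $[x_k]$ is reciprocal if and only if it is governed by a forward $CM_c$ model (1) with that boundary condition whose parameters satisfy $$G_k^{-1}G_{k,c}=G_{k+1,k}'\,G_{k+1}^{-1}G_{k+1,c}\tag{4}$$ for all $k\in\{1,\dots,N-2\}$ if $c=N$, and for all $k\in\{2,\dots,N-1\}$ if $c=0$. (ii) $[x_k]$ is Markov if and only if it is governed by such a model whose parameters satisfy (4) and, in addition: for $c=N$, $$G_N^{-1}G_{N,0}=G_{1,N}'\,G_1^{-1}G_{1,0}\quad\text{with boundary condition (2)},\tag{5}$$ $$G_0^{-1}G_{0,N}=G_{1,0}'\,G_1^{-1}G_{1,N}\quad\text{with boundary condition (3)};\tag{6}$$ for $c=0$, $G_{N,0}=0$. (iii)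 If $[x_k]$ is governed by (1) with the chosen boundary condition, with any parameters, then it is reciprocal if and only if these parameters satisfy (4), and Markov if and only if they satisfy (4) and the additional condition in (ii). Moreover, for $c=N$, (5) and (6) are equivalent: if $[x_k]$ is governed both by a model (1), (2) and by a model (1), (3), each satisfying (4), then (5) holds for the first if and only if (6) holds for the second. -/

import Mathlib

open MeasureTheory ProbabilityTheory
open scoped Matrix

namespace GaussSeq

/-- The σ-algebra generated by the states `x i`, `i ∈ S`. -/
abbrev sigmaOf {Ω : Type*} {N d : ℕ} (x : Fin (N + 1) → Ω → Fin d → ℝ)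
    (S : Set (Fin (N + 1))) : MeasurableSpace Ω :=
  ⨆ i ∈ S, MeasurableSpace.comap (x i) inferInstance

/-- Conditional independence of the σ-algebras `m₁` and `m₂` given `m`:
`P(A ∩ B | m) = P(A | m) P(B | m)` almost surely for all `A ∈ m₁`, `B ∈ m₂`
(no assumption on the underlying probability space). -/
def CondIndepGiven {Ω : Type*} [MeasurableSpace Ω] (μ : Measure Ω)
    (m m₁ m₂ : MeasurableSpace Ω) : Prop :=
  ∀ A B : Set Ω, MeasurableSet[m₁] A → MeasurableSet[m₂] B →
    μ⟦A ∩ B | m⟧ =ᵐ[μ] μ⟦A | m⟧ * μ⟦B | m⟧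

/-- Markov: given the state at any time `k`, the subsequences before and after `k` are
independent. -/
def IsMarkov {Ω : Type*} [MeasurableSpace Ω] (μ : Measure Ω) {N d : ℕ}
    (x : Fin (N + 1) → Ω → Fin d → ℝ) : Prop :=
  ∀ k : Fin (N + 1),
    CondIndepGiven μ (sigmaOf x {k}) (sigmaOf x {i | i < k}) (sigmaOf x {i | k < i})

/-- Reciprocal: given the states at any two times `k₁ < k₂`, the subsequences inside and
outside the interval `[k₁, k₂]` are independent. -/
def IsReciprocal {Ω : Type*} [MeasurableSpace Ω] (μ : Measure Ω) {N d : ℕ}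
    (x : Fin (N + 1) → Ω → Fin d → ℝ) : Prop :=
  ∀ k₁ k₂ : Fin (N + 1), k₁ < k₂ →
    CondIndepGiven μ (sigmaOf x {k₁, k₂}) (sigmaOf x {i | k₁ < i ∧ i < k₂})
      (sigmaOf x {i | i < k₁ ∨ k₂ < i})

/-- The cross-covariance matrix `C_{k,l}` of `x k` and `x l`. -/
noncomputable def covFun {Ω : Type*} [MeasurableSpace Ω] (μ : Measure Ω) {N d : ℕ}
    (x : Fin (N + 1) → Ω → Fin d → ℝ) (k l : Fin (N + 1)) : Matrix (Fin d) (Fin d) ℝ :=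
  Matrix.of fun a b => cov[fun ω => x k ω a, fun ω => x l ω b; μ]

/-- The covariance matrix `C` of the whole sequence, with `(k, l)` block `C_{k,l}`. -/
noncomputable def covMatrix {Ω : Type*} [MeasurableSpace Ω] (μ : Measure Ω) {N d : ℕ}
    (x : Fin (N + 1) → Ω → Fin d → ℝ) :
    Matrix (Fin (N + 1) × Fin d) (Fin (N + 1) × Fin d) ℝ :=
  Matrix.of fun p q => covFun μ x p.1 q.1 p.2 q.2

/-- A zero-mean (jointly) Gaussian sequence of random vectors in `ℝ^d`. -/
structure IsZeroMeanGaussian {Ω : Type*} [MeasurableSpace Ω] (μ : Measure Ω) {N d : ℕ}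
    (x : Fin (N + 1) → Ω → Fin d → ℝ) : Prop where
  measurable : ∀ k, Measurable (x k)
  gaussian : HasGaussianLaw (fun ω k => x k ω) μ
  mean_zero : ∀ k, ∫ ω, x k ω ∂μ = 0

/-- A zero-mean nonsingular Gaussian sequence: its covariance matrix is positive definite. -/
structure IsZMNG {Ω : Type*} [MeasurableSpace Ω] (μ : Measure Ω) {N d : ℕ}
    (x : Fin (N + 1) → Ω → Fin d → ℝ) : Prop extends IsZeroMeanGaussian μ x where
  nonsingular : (covMatrix μ x).PosDef

/-- A zero-mean white (uncorrelated over time) Gaussian sequence `e` with nonsingular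
covariances `Q k`. -/
structure IsWhiteGaussian {Ω : Type*} [MeasurableSpace Ω] (μ : Measure Ω) {N d : ℕ}
    (e : Fin (N + 1) → Ω → Fin d → ℝ) (Q : Fin (N + 1) → Matrix (Fin d) (Fin d) ℝ) : Prop
    extends IsZeroMeanGaussian μ e where
  white : ∀ k l, k ≠ l → covFun μ e k l = 0
  cov_eq : ∀ k, covFun μ e k k = Q k
  nonsingular : ∀ k, (Q k).PosDef

/-- `x_k = G_{k,k-1} x_{k-1} + G_{k,c} x_c + e_k` for `k ∈ (0, N] \ {c}`; here `k` is `i.succ`.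
(For `c = 0` and `k = 1` both coefficients are `G_{1,0}`.) -/
def ForwardModel {Ω : Type*} [MeasurableSpace Ω] (μ : Measure Ω) {N d : ℕ}
    (c : Fin (N + 1)) (x e : Fin (N + 1) → Ω → Fin d → ℝ)
    (G : Fin (N + 1) → Fin (N + 1) → Matrix (Fin d) (Fin d) ℝ) : Prop :=
  ∀ i : Fin N, i.succ ≠ c → ∀ᵐ ω ∂μ,
    x i.succ ω = G i.succ i.castSucc *ᵥ x i.castSucc ω + G i.succ c *ᵥ x c ω + e i.succ ω

/-- The two forms of the boundary condition. -/
inductive BoundaryForm where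
  | startFirst
  | condFirst

/-- The boundary condition.
`startFirst`: `x_0 = e_0`, and, for `c = N`, `x_c = G_{c,0} x_0 + e_c`.
`condFirst`: `x_c = e_c`, and, for `c = N`, `x_0 = G_{0,c} x_c + e_0`. -/
def Boundary {Ω : Type*} [MeasurableSpace Ω] (μ : Measure Ω) {N d : ℕ}
    (c : Fin (N + 1)) (x e : Fin (N + 1) → Ω → Fin d → ℝ)
    (G : Fin (N + 1) → Fin (N + 1) → Matrix (Fin d) (Fin d) ℝ) : BoundaryForm → Prop
  | .startFirst => (∀ᵐ ω ∂μ, x 0 ω = e 0 ω) ∧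
      (c = Fin.last N → ∀ᵐ ω ∂μ, x c ω = G c 0 *ᵥ x 0 ω + e c ω)
  | .condFirst => (∀ᵐ ω ∂μ, x c ω = e c ω) ∧
      (c = Fin.last N → ∀ᵐ ω ∂μ, x 0 ω = G 0 c *ᵥ x c ω + e 0 ω)

/-- `x` is governed by the forward `CM_c` model with coefficients `G`, driven by zero-mean white
Gaussian noise with nonsingular covariances `Q`, with the boundary condition of form `b`. -/
def GovernedBy {Ω : Type*} [MeasurableSpace Ω] (μ : Measure Ω) {N d : ℕ}
    (c : Fin (N + 1)) (b : BoundaryForm) (x : Fin (N + 1) → Ω → Fin d → ℝ)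
    (G : Fin (N + 1) → Fin (N + 1) → Matrix (Fin d) (Fin d) ℝ)
    (Q : Fin (N + 1) → Matrix (Fin d) (Fin d) ℝ) : Prop :=
  ∃ e : Fin (N + 1) → Ω → Fin d → ℝ,
    IsWhiteGaussian μ e Q ∧ ForwardModel μ c x e G ∧ Boundary μ c x e G b

/-- `G_k⁻¹ G_{k,c} = G_{k+1,k}' G_{k+1}⁻¹ G_{k+1,c}` for all `k ∈ (0, N-1)` if `c = N`, and for all
`k ∈ (1, N)` if `c = 0`; here `k` is `i.castSucc`, and `Q k` is the noise covariance `G_k`. -/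
def ReciprocalCondition {N d : ℕ} (c : Fin (N + 1))
    (G : Fin (N + 1) → Fin (N + 1) → Matrix (Fin d) (Fin d) ℝ)
    (Q : Fin (N + 1) → Matrix (Fin d) (Fin d) ℝ) : Prop :=
  ∀ i : Fin N,
    ((c = Fin.last N ∧ 0 < (i : ℕ) ∧ (i : ℕ) + 1 < N) ∨ (c = 0 ∧ 1 < (i : ℕ) ∧ (i : ℕ) < N)) →
    (Q i.castSucc)⁻¹ * G i.castSucc c = (G i.succ i.castSucc)ᵀ * (Q i.succ)⁻¹ * G i.succ c

/-- The additional condition for the Markov property. For `c = N`, it is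
`G_N⁻¹ G_{N,0} = G_{1,N}' G_1⁻¹ G_{1,0}` with the boundary condition `startFirst`, and
`G_0⁻¹ G_{0,N} = G_{1,0}' G_1⁻¹ G_{1,N}` with `condFirst`. For `c = 0`, it is `G_{N,0} = 0`. -/
def MarkovCondition {N d : ℕ} (c : Fin (N + 1)) (b : BoundaryForm)
    (G : Fin (N + 1) → Fin (N + 1) → Matrix (Fin d) (Fin d) ℝ)
    (Q : Fin (N + 1) → Matrix (Fin d) (Fin d) ℝ) : Prop :=
  (c = Fin.last N → match b with
    | .startFirst =>
        (Q (Fin.last N))⁻¹ * G (Fin.last N) 0 = (G 1 (Fin.last N))ᵀ * (Q 1)⁻¹ * G 1 0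
    | .condFirst =>
        (Q 0)⁻¹ * G 0 (Fin.last N) = (G 1 0)ᵀ * (Q 1)⁻¹ * G 1 (Fin.last N)) ∧
  (c = 0 → G (Fin.last N) 0 = 0)

end GaussSeq

/-! Everything is read off the inverse covariance matrix P = C⁻¹. For a nonsingular Gaussian
sequence, if S, K, T partition the times, then x_S and x_T are conditionally independent given x_K
exactly when the (S, T) part of P vanishes (`IsZMNG.condIndepGiven_iff`). Hence Markov means that P
is block tridiagonal, and reciprocal means the same up to the corner blocks (0, N) and (N, 0).

A model x = Bx + e with white noise of covariance Q gives P = (1 - B)' Q⁻¹ (1 - B)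
(`IsZeroMeanGaussian.precision_eq`). For a CM_c model the blocks off the three diagonals vanish
automatically outside row and column c. Those in row c, apart from the corner, vanish exactly under
the reciprocal condition, and the corner exactly under the Markov condition. This settles any given
model. The corner of P depends on the sequence alone, so the Markov conditions for the two boundary
forms are equivalent.

It remains to find a model for a reciprocal sequence (`IsZMNG.exists_governedBy`): each state is
regressed on its predecessors in a suitable order, and the zeros of P make the residuals white. -/

namespace GaussSeq

/-! ### Conditional independence of σ-algebras -/

section CondIndep

variable {Ω : Type*} {m m₁ m₂ m₁' m₂' : MeasurableSpace Ω} [mΩ : MeasurableSpace Ω]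
  {μ : Measure Ω}

lemma CondIndepGiven.mono (h : CondIndepGiven μ m m₁ m₂)
    (h₁ : m₁' ≤ m₁) (h₂ : m₂' ≤ m₂) : CondIndepGiven μ m m₁' m₂' :=
  fun A B hA hB => h A B (h₁ _ hA) (h₂ _ hB)

lemma integrable_indicator_mul_condExp {A B : Set Ω} (hA : MeasurableSet A) :
    Integrable ((A.indicator fun _ => (1 : ℝ)) * μ⟦B | m⟧) μ := by
  have : (A.indicator fun _ => (1 : ℝ)) * μ⟦B | m⟧ = A.indicator (μ⟦B | m⟧) := by
    ext ω; by_cases h : ω ∈ A <;> simp [h]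
  rw [this]
  exact integrable_condExp.indicator hA

lemma setIntegral_indicator_mul {A K : Set Ω} (hA : MeasurableSet A) (f : Ω → ℝ) :
    ∫ ω in K, ((A.indicator fun _ => (1 : ℝ)) * f) ω ∂μ = ∫ ω in A ∩ K, f ω ∂μ := by
  have : (A.indicator fun _ => (1 : ℝ)) * f = A.indicator f := by
    ext ω; by_cases h : ω ∈ A <;> simp [h]
  rw [this, integral_indicator hA, Measure.restrict_restrict hA]

variable [IsProbabilityMeasure μ]

lemma integrable_indicator_one {A : Set Ω} (hA : MeasurableSet A) :
    Integrable (A.indicator fun _ => (1 : ℝ)) μ :=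
  (integrable_const 1).indicator hA

lemma condExp_indicator_mem_Icc {B : Set Ω} (hB : MeasurableSet B) :
    ∀ᵐ ω ∂μ, 0 ≤ (μ⟦B | m⟧) ω ∧ (μ⟦B | m⟧) ω ≤ 1 := by
  by_cases hm : m ≤ mΩ
  swap
  -- Here the conditional expectation has its default value 0.
  · exact ae_of_all _ fun ω => by simp [condExp_of_not_le hm]
  have h0 : 0 ≤ᵐ[μ] μ⟦B | m⟧ :=
    condExp_nonneg (ae_of_all _ fun ω => Set.indicator_nonneg (fun _ _ => zero_le_one) ω)
  have h1 : μ⟦B | m⟧ ≤ᵐ[μ] μ[fun _ => (1 : ℝ) | m] :=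
    condExp_mono (integrable_indicator_one hB) (integrable_const 1)
      (ae_of_all _ fun ω => Set.indicator_le_self' (fun _ _ => zero_le_one) ω)
  rw [condExp_const hm] at h1
  filter_upwards [h0, h1] with ω a b using ⟨a, b⟩

/-- Conditional independence expressed by the conditional probability of one side only. -/
lemma condIndepGiven_iff_setIntegral (hm : m ≤ mΩ) (h₁ : m₁ ≤ mΩ) (h₂ : m₂ ≤ mΩ) :
    CondIndepGiven μ m m₁ m₂ ↔ ∀ A B K : Set Ω, MeasurableSet[m₁] A → MeasurableSet[m₂] B →
      MeasurableSet[m] K → μ.real (B ∩ (A ∩ K)) = ∫ ω in A ∩ K, (μ⟦B | m⟧) ω ∂μ := by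
  -- The pull-out property turns the product of conditional probabilities into the conditional
  -- expectation of 1_A P(B | m), which is then compared with 1_{A ∩ B} by integrating over sets of
  -- `m`.
  have key : ∀ A B : Set Ω, MeasurableSet[m₁] A →
      μ[(A.indicator fun _ => (1 : ℝ)) * μ⟦B | m⟧ | m] =ᵐ[μ] μ⟦A | m⟧ * μ⟦B | m⟧ := fun A B hA =>
    condExp_mul_of_stronglyMeasurable_right stronglyMeasurable_condExp
      (integrable_indicator_mul_condExp (h₁ _ hA)) (integrable_indicator_one (h₁ _ hA))
  have left : ∀ A B K : Set Ω, MeasurableSet[m₁] A → MeasurableSet[m₂] B → MeasurableSet[m] K →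
      ∫ ω in K, (A ∩ B).indicator (fun _ => (1 : ℝ)) ω ∂μ = μ.real (B ∩ (A ∩ K)) := by
    intro A B K hA hB hK
    rw [integral_indicator ((h₁ _ hA).inter (h₂ _ hB)),
      Measure.restrict_restrict ((h₁ _ hA).inter (h₂ _ hB))]
    simp only [integral_const, smul_eq_mul, mul_one, measureReal_restrict_apply_univ]
    congr 1; ext; simp; tauto
  constructor
  · intro h A B K hA hB hK
    rw [← setIntegral_indicator_mul (h₁ _ hA), ← setIntegral_condExp hm
      (integrable_indicator_mul_condExp (h₁ _ hA)) hK, ← left A B K hA hB hK,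
      ← setIntegral_condExp hm (integrable_indicator_one ((h₁ _ hA).inter (h₂ _ hB))) hK]
    exact integral_congr_ae (ae_restrict_of_ae ((h A B hA hB).trans (key A B hA).symm))
  · intro h A B hA hB
    refine Filter.EventuallyEq.trans ?_ (key A B hA)
    refine (ae_eq_condExp_of_forall_setIntegral_eq hm
      (integrable_indicator_mul_condExp (h₁ _ hA)) (fun _ _ _ => integrable_condExp.integrableOn)
      (fun K hK _ => ?_) stronglyMeasurable_condExp.aestronglyMeasurable)
    rw [setIntegral_indicator_mul (h₁ _ hA), ← h A B K hA hB hK, setIntegral_condExp hm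
      (integrable_indicator_one ((h₁ _ hA).inter (h₂ _ hB))) hK, left A B K hA hB hK]

/-- The conditioning σ-algebra can be adjoined to one side. -/
lemma CondIndepGiven.sup_left (hm : m ≤ mΩ) (h₁ : m₁ ≤ mΩ) (h₂ : m₂ ≤ mΩ)
    (h : CondIndepGiven μ m m₁ m₂) : CondIndepGiven μ m (m₁ ⊔ m) m₂ := by
  rw [condIndepGiven_iff_setIntegral hm h₁ h₂] at h
  rw [condIndepGiven_iff_setIntegral hm (sup_le h₁ hm) h₂]
  intro A B K hA hB hK
  have hI := condExp_indicator_mem_Icc (m := m) (μ := μ) (h₂ _ hB)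
  -- The finite measures s ↦ μ(B ∩ s) and s ↦ ∫_s P(B | m) agree on the sets A ∩ K, a π-system
  -- generating `m₁ ⊔ m`, hence on all of `m₁ ⊔ m`. Trimming restricts both to that σ-algebra.
  let f : Ω → ENNReal := fun ω => ENNReal.ofReal ((μ⟦B | m⟧) ω)
  have hf : ∀ s, MeasurableSet s → (μ.withDensity f) s =
      ENNReal.ofReal (∫ ω in s, (μ⟦B | m⟧) ω ∂μ) := by
    intro s hs
    rw [withDensity_apply _ hs, ofReal_integral_eq_lintegral_ofReal
      integrable_condExp.integrableOn (ae_restrict_of_ae (hI.mono fun ω h => h.1))]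
  have hfin : IsFiniteMeasure (μ.withDensity f) := by
    refine ⟨?_⟩
    rw [hf _ MeasurableSet.univ]
    exact ENNReal.ofReal_lt_top
  have hgen : m₁ ⊔ m = MeasurableSpace.generateFrom
      {s | ∃ A K : Set Ω, MeasurableSet[m₁] A ∧ MeasurableSet[m] K ∧ s = A ∩ K} := by
    apply le_antisymm
    · refine sup_le (fun s hs => ?_) (fun s hs => ?_)
      · exact MeasurableSpace.measurableSet_generateFrom
          ⟨s, Set.univ, hs, MeasurableSet.univ, by simp⟩
      · exact MeasurableSpace.measurableSet_generateFrom
          ⟨Set.univ, s, MeasurableSet.univ, hs, by simp⟩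
    · refine MeasurableSpace.generateFrom_le ?_
      rintro s ⟨A, K, hA, hK, rfl⟩
      exact MeasurableSet.inter ((le_sup_left : m₁ ≤ m₁ ⊔ m) _ hA)
        ((le_sup_right : m ≤ m₁ ⊔ m) _ hK)
  have hle : m₁ ⊔ m ≤ mΩ := sup_le h₁ hm
  have basic : ∀ A K : Set Ω, MeasurableSet[m₁] A → MeasurableSet[m] K →
      μ (B ∩ (A ∩ K)) = (μ.withDensity f) (A ∩ K) := by
    intro A K hA hK
    rw [hf _ ((h₁ _ hA).inter (hm _ hK)), ← h A B K hA hB hK, ofReal_measureReal]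
  have hext : ∀ s, MeasurableSet[m₁ ⊔ m] s → μ (B ∩ s) = (μ.withDensity f) s := by
    have : (μ.restrict B).trim hle = (μ.withDensity f).trim hle := by
      refine ext_of_generate_finite _ hgen ?_ ?_ ?_
      · rintro _ ⟨A, K, hA, hK, rfl⟩ _ ⟨A', K', hA', hK', rfl⟩ -
        exact ⟨A ∩ A', K ∩ K', hA.inter hA', hK.inter hK', by ext; simp; tauto⟩
      · rintro _ ⟨A, K, hA, hK, rfl⟩
        have hAK : MeasurableSet[m₁ ⊔ m] (A ∩ K) := MeasurableSet.inter
          ((le_sup_left : m₁ ≤ m₁ ⊔ m) _ hA) ((le_sup_right : m ≤ m₁ ⊔ m) _ hK)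
        rw [trim_measurableSet_eq hle hAK, trim_measurableSet_eq hle hAK,
          Measure.restrict_apply (hle _ hAK), Set.inter_comm, basic A K hA hK]
      · rw [trim_measurableSet_eq hle MeasurableSet.univ,
          trim_measurableSet_eq hle MeasurableSet.univ, Measure.restrict_apply MeasurableSet.univ,
          Set.inter_comm]
        simpa using basic Set.univ Set.univ MeasurableSet.univ MeasurableSet.univ
    intro s hs
    rw [← trim_measurableSet_eq hle hs, ← this, trim_measurableSet_eq hle hs,
      Measure.restrict_apply (hle _ hs), Set.inter_comm]
  have hAK : MeasurableSet[m₁ ⊔ m] (A ∩ K) :=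
    MeasurableSet.inter hA ((le_sup_right : m ≤ m₁ ⊔ m) _ hK)
  rw [measureReal_def, hext _ hAK, hf _ (hle _ hAK), ENNReal.toReal_ofReal]
  exact integral_nonneg_of_ae (ae_restrict_of_ae (hI.mono fun ω h => h.1))

lemma condExp_indicator_of_indep (hm : m ≤ mΩ) (h₁ : m₁ ≤ mΩ) (h : Indep m₁ m μ) {A : Set Ω}
    (hA : MeasurableSet[m₁] A) : μ⟦A | m⟧ =ᵐ[μ] fun _ => μ.real A := by
  refine (condExp_indep_eq h₁ hm (stronglyMeasurable_const.indicator hA) h).trans ?_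
  rw [integral_indicator (h₁ _ hA)]
  simp

/-- A σ-algebra independent of `m ⊔ m₂` is conditionally independent of `m₂` given `m`. -/
lemma condIndepGiven_of_indep_sup (hm : m ≤ mΩ) (h₁ : m₁ ≤ mΩ) (h₂ : m₂ ≤ mΩ)
    (h : Indep m₁ (m ⊔ m₂) μ) : CondIndepGiven μ m m₁ m₂ := by
  have hi : Indep m₁ m μ := indep_of_indep_of_le_right h le_sup_left
  rw [Indep_iff] at h
  intro A B hA hB
  refine Filter.EventuallyEq.trans (Filter.EventuallyEq.symm ?_)
    (((condExp_indicator_of_indep hm h₁ hi hA).mul (ae_eq_refl (μ⟦B | m⟧))).symm)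
  refine ae_eq_condExp_of_forall_setIntegral_eq hm
    (integrable_indicator_one ((h₁ _ hA).inter (h₂ _ hB)))
    (fun K _ _ => (integrable_condExp.const_mul _).integrableOn) (fun K hK _ => ?_)
    (stronglyMeasurable_const.mul stronglyMeasurable_condExp).aestronglyMeasurable
  simp only [Pi.mul_apply]
  rw [integral_const_mul, setIntegral_condExp hm (integrable_indicator_one (h₂ _ hB)) hK,
    integral_indicator (h₂ _ hB), integral_indicator ((h₁ _ hA).inter (h₂ _ hB)),
    Measure.restrict_restrict (h₂ _ hB), Measure.restrict_restrict ((h₁ _ hA).inter (h₂ _ hB))]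
  simp only [integral_const, smul_eq_mul, mul_one, measureReal_restrict_apply_univ]
  rw [Set.inter_assoc, measureReal_def, measureReal_def, measureReal_def, ← ENNReal.toReal_mul,
    h A (B ∩ K) hA (MeasurableSet.inter ((le_sup_right : m₂ ≤ m ⊔ m₂) _ hB)
      ((le_sup_left : m ≤ m ⊔ m₂) _ hK))]

/-- Conditional independence given `m` is independence for a σ-algebra independent of `m`. -/
lemma CondIndepGiven.indep (hm : m ≤ mΩ) (h₁ : m₁ ≤ mΩ) (h₂ : m₂ ≤ mΩ)
    (h : CondIndepGiven μ m m₁ m₂) (hi : Indep m₁ m μ) : Indep m₁ m₂ μ := by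
  rw [Indep_iff]
  intro A B hA hB
  have hAB := (h A B hA hB).trans
    ((condExp_indicator_of_indep hm h₁ hi hA).mul (ae_eq_refl (μ⟦B | m⟧)))
  have := integral_congr_ae hAB
  simp only [Pi.mul_apply] at this
  rw [integral_condExp hm, integral_const_mul, integral_condExp hm, integral_indicator (h₂ _ hB),
    integral_indicator ((h₁ _ hA).inter (h₂ _ hB))] at this
  simp only [integral_const, smul_eq_mul, mul_one, measureReal_restrict_apply_univ] at this
  rw [measureReal_def, measureReal_def, measureReal_def, ← ENNReal.toReal_mul] at this
  exact (ENNReal.toReal_eq_toReal_iff' (by finiteness) (by finiteness)).1 this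

end CondIndep

/-! ### Linear combinations of jointly Gaussian states -/

section Linear

variable {Ω : Type*} {N d : ℕ} {x : Fin (N + 1) → Ω → Fin d → ℝ} {ι κ : Type*}

/-- The states of the sequence stacked in one vector. -/
def stack (x : Fin (N + 1) → Ω → Fin d → ℝ) (ω : Ω) (p : Fin (N + 1) × Fin d) : ℝ := x p.1 ω p.2

lemma sigmaOf_union (S T : Set (Fin (N + 1))) : sigmaOf x (S ∪ T) = sigmaOf x S ⊔ sigmaOf x T :=
  iSup_union

lemma measurable_stack_sigmaOf {S : Set (Fin (N + 1))} {p : Fin (N + 1) × Fin d} (hp : p.1 ∈ S) :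
    Measurable[sigmaOf x S] fun ω => stack x ω p := by
  have h : Measurable[sigmaOf x S] (x p.1) :=
    measurable_iff_comap_le.2 (le_iSup₂_of_le p.1 hp le_rfl)
  exact (measurable_pi_apply p.2).comp h

lemma sigmaOf_le_iff {S : Set (Fin (N + 1))} {m : MeasurableSpace Ω} :
    sigmaOf x S ≤ m ↔
      ∀ p : Fin (N + 1) × Fin d, p.1 ∈ S → Measurable[m] fun ω => stack x ω p := by
  constructor
  · exact fun h p hp => (measurable_stack_sigmaOf hp).mono h le_rfl
  · intro h
    refine iSup₂_le fun i hi => measurable_iff_comap_le.1 ?_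
    exact measurable_pi_lambda _ fun a => h (i, a) hi

lemma measurable_mulVec_stack {m : MeasurableSpace Ω} {L : Matrix ι (Fin (N + 1) × Fin d) ℝ}
    (h : ∀ p : Fin (N + 1) × Fin d, Measurable[m] (fun ω => stack x ω p) ∨ ∀ i, L i p = 0) :
    Measurable[m] fun ω => L *ᵥ stack x ω := by
  refine measurable_pi_lambda _ fun i => ?_
  simp only [Matrix.mulVec, dotProduct]
  refine Finset.measurable_sum _ fun p _ => ?_
  rcases h p with h | h
  · exact h.const_mul _
  · simp [h i]

variable [mΩ : MeasurableSpace Ω] {μ : Measure Ω}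

lemma covMatrix_apply (p q : Fin (N + 1) × Fin d) :
    covMatrix μ x p q = cov[fun ω => stack x ω p, fun ω => stack x ω q; μ] := rfl

lemma sigmaOf_le (hx : ∀ k, Measurable (x k)) (S : Set (Fin (N + 1))) : sigmaOf x S ≤ mΩ :=
  iSup₂_le fun i _ => (hx i).comap_le

lemma IsZeroMeanGaussian.hasGaussianLaw_stack (hx : IsZeroMeanGaussian μ x) :
    HasGaussianLaw (stack x) μ := by
  let Φ : (Fin (N + 1) → Fin d → ℝ) →L[ℝ] (Fin (N + 1) × Fin d → ℝ) :=
    ContinuousLinearMap.pi fun p =>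
      (ContinuousLinearMap.proj (R := ℝ) (φ := fun _ : Fin d => ℝ) p.2).comp
        (ContinuousLinearMap.proj (R := ℝ) (φ := fun _ : Fin (N + 1) => Fin d → ℝ) p.1)
  exact hx.gaussian.map_fun Φ

lemma IsZeroMeanGaussian.hasGaussianLaw_mulVec [Fintype ι] (hx : IsZeroMeanGaussian μ x)
    (L : Matrix ι (Fin (N + 1) × Fin d) ℝ) : HasGaussianLaw (fun ω => L *ᵥ stack x ω) μ :=
  hx.hasGaussianLaw_stack.map_fun (LinearMap.toContinuousLinearMap (Matrix.mulVecLin L))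

lemma IsZeroMeanGaussian.memLp_stack (hx : IsZeroMeanGaussian μ x) (p : Fin (N + 1) × Fin d) :
    MemLp (fun ω => stack x ω p) 2 μ :=
  (hx.hasGaussianLaw_stack.eval p).memLp_two

lemma IsZeroMeanGaussian.memLp_mulVec (hx : IsZeroMeanGaussian μ x)
    (L : Matrix ι (Fin (N + 1) × Fin d) ℝ) (i : ι) :
    MemLp (fun ω => (L *ᵥ stack x ω) i) 2 μ := by
  simp only [Matrix.mulVec, dotProduct]
  exact memLp_finsetSum _ fun p _ => (hx.memLp_stack p).const_mul _

lemma IsZeroMeanGaussian.isProbabilityMeasure (hx : IsZeroMeanGaussian μ x) :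
    IsProbabilityMeasure μ := hx.gaussian.isProbabilityMeasure

lemma IsZeroMeanGaussian.cov_mulVec (hx : IsZeroMeanGaussian μ x)
    (L : Matrix ι (Fin (N + 1) × Fin d) ℝ) (M : Matrix κ (Fin (N + 1) × Fin d) ℝ) (i : ι) (j : κ) :
    cov[fun ω => (L *ᵥ stack x ω) i, fun ω => (M *ᵥ stack x ω) j; μ] =
      (L * covMatrix μ x * Mᵀ) i j := by
  have := hx.isProbabilityMeasure
  simp only [Matrix.mulVec, dotProduct]
  rw [covariance_fun_sum_fun_sum (fun p => (hx.memLp_stack p).const_mul _)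
    (fun p => (hx.memLp_stack p).const_mul _)]
  simp only [covariance_const_mul_left, covariance_const_mul_right, ← covMatrix_apply,
    Matrix.mul_apply, Matrix.transpose_apply, Finset.sum_mul]
  rw [Finset.sum_comm]
  exact Finset.sum_congr rfl fun _ _ => Finset.sum_congr rfl fun _ _ => by ring

lemma IsZeroMeanGaussian.cov_mulVec_stack (hx : IsZeroMeanGaussian μ x)
    (L : Matrix ι (Fin (N + 1) × Fin d) ℝ) (i : ι) (p : Fin (N + 1) × Fin d) :
    cov[fun ω => (L *ᵥ stack x ω) i, fun ω => stack x ω p; μ] = (L * covMatrix μ x) i p := by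
  simpa using hx.cov_mulVec L (1 : Matrix (Fin (N + 1) × Fin d) (Fin (N + 1) × Fin d) ℝ) i p

/-- Linear combinations of the states that are uncorrelated with the states at times in `T` are
independent of them. -/
lemma IsZeroMeanGaussian.indep_sigmaOf [Fintype ι] (hx : IsZeroMeanGaussian μ x)
    {L : Matrix ι (Fin (N + 1) × Fin d) ℝ} {T : Set (Fin (N + 1))}
    (h : ∀ i p, p.1 ∈ T → (L * covMatrix μ x) i p = 0) :
    Indep (MeasurableSpace.comap (fun ω => L *ᵥ stack x ω) inferInstance) (sigmaOf x T) μ := by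
  classical
  -- `R` selects the coordinates at times in `T`. The pair (Lx, Rx) is one linear image of the
  -- sequence, hence jointly Gaussian, so zero covariance gives independence.
  let R : Matrix {p : Fin (N + 1) × Fin d // p.1 ∈ T} (Fin (N + 1) × Fin d) ℝ :=
    (1 : Matrix _ _ ℝ).submatrix Subtype.val id
  have hR : ∀ ω (p : {p : Fin (N + 1) × Fin d // p.1 ∈ T}),
      (R *ᵥ stack x ω) p = stack x ω p := fun ω p => by
    simp [R, Matrix.mulVec, dotProduct, Matrix.one_apply]
  have hg : HasGaussianLaw (fun ω => (fun i => (L *ᵥ stack x ω) i,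
      fun j : {p : Fin (N + 1) × Fin d // p.1 ∈ T} => stack x ω j)) μ := by
    have := hx.hasGaussianLaw_stack.map_fun ((LinearMap.toContinuousLinearMap
      (Matrix.mulVecLin L)).prod (LinearMap.toContinuousLinearMap (Matrix.mulVecLin R)))
    have heq : (fun ω => (fun i => (L *ᵥ stack x ω) i,
        fun j : {p : Fin (N + 1) × Fin d // p.1 ∈ T} => stack x ω j)) =
        fun ω => (L *ᵥ stack x ω, R *ᵥ stack x ω) :=
      funext fun ω => Prod.ext rfl (funext fun j => (hR ω j).symm)
    rw [heq]
    exact this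
  have hind := hg.indepFun_of_covariance_eval fun i j => by
    rw [hx.cov_mulVec_stack L i j.1]; exact h i j.1 j.2
  rw [IndepFun_iff_Indep] at hind
  refine indep_of_indep_of_le_right hind (sigmaOf_le_iff.2 fun p hp => ?_)
  exact (measurable_pi_apply (⟨p, hp⟩ : {p : Fin (N + 1) × Fin d // p.1 ∈ T})).comp
    (comap_measurable fun ω (j : {p : Fin (N + 1) × Fin d // p.1 ∈ T}) => stack x ω j)

/-- If `L x` depends on the states at times in `S ∪ K` only and is uncorrelated with those in `K`,
then it is uncorrelated with the states at times in `T`, when the latter are conditionally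
independent of those in `S` given those in `K`. -/
lemma IsZeroMeanGaussian.mul_covMatrix_eq_zero [Fintype ι] (hx : IsZeroMeanGaussian μ x)
    {S K T : Set (Fin (N + 1))}
    (h : CondIndepGiven μ (sigmaOf x K) (sigmaOf x S) (sigmaOf x T))
    {L : Matrix ι (Fin (N + 1) × Fin d) ℝ} (hL : ∀ i p, p.1 ∉ S → p.1 ∉ K → L i p = 0)
    (hK : ∀ i p, p.1 ∈ K → (L * covMatrix μ x) i p = 0) (i : ι) (p : Fin (N + 1) × Fin d)
    (hp : p.1 ∈ T) : (L * covMatrix μ x) i p = 0 := by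
  have := hx.isProbabilityMeasure
  have hle := sigmaOf_le hx.measurable
  have hmeas : Measurable[sigmaOf x S ⊔ sigmaOf x K] fun ω => L *ᵥ stack x ω := by
    refine measurable_mulVec_stack fun p => ?_
    by_cases hS : p.1 ∈ S
    · exact Or.inl ((measurable_stack_sigmaOf hS).mono le_sup_left le_rfl)
    by_cases hK : p.1 ∈ K
    · exact Or.inl ((measurable_stack_sigmaOf hK).mono le_sup_right le_rfl)
    · exact Or.inr fun i => hL i p hS hK
  -- Lx is a function of the states in `S ∪ K`, so it is conditionally independent of `T` given `K`.
  -- It is also independent of `K`, being uncorrelated with it, so it is independent of `T`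
  -- outright.
  have hc := (h.sup_left (hle _) (hle _) (hle _)).mono (measurable_iff_comap_le.1 hmeas) le_rfl
  have hind := hc.indep (hle _)
    ((measurable_iff_comap_le.1 hmeas).trans (sup_le (hle _) (hle _))) (hle _)
    (hx.indep_sigmaOf hK)
  rw [← hx.cov_mulVec_stack]
  refine IndepFun.covariance_eq_zero ?_ (hx.memLp_mulVec L i) (hx.memLp_stack p)
  rw [IndepFun_iff_Indep]
  refine indep_of_indep_of_le_left (indep_of_indep_of_le_right hind ?_) ?_
  · exact measurable_iff_comap_le.1 (measurable_stack_sigmaOf hp)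
  · exact measurable_iff_comap_le.1 ((measurable_pi_apply i).comp
      (comap_measurable fun ω => L *ᵥ stack x ω))

end Linear

/-! ### Conditional independence and the inverse covariance matrix -/

section Precision

variable {Ω : Type*} [mΩ : MeasurableSpace Ω] {μ : Measure Ω} {N d : ℕ}
  {x : Fin (N + 1) → Ω → Fin d → ℝ}

/-- The linear regression of a vector with nonsingular covariance `C` on a subvector. -/
lemma exists_regression {J : Type*} [Fintype J] [DecidableEq J] {C : Matrix J J ℝ} (hC : C.PosDef)
    (K : Set J) : ∃ A : Matrix J J ℝ, (∀ p q, q ∉ K → A p q = 0) ∧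
      ∀ p q, q ∈ K → ((1 - A) * C) p q = 0 := by
  classical
  let R : Matrix {p // p ∈ K} J ℝ := (1 : Matrix J J ℝ).submatrix Subtype.val id
  let CK : Matrix {p // p ∈ K} {p // p ∈ K} ℝ := C.submatrix Subtype.val Subtype.val
  have hK : CK.PosDef := hC.submatrix Subtype.val_injective
  -- The solution of the normal equations. The factor `R` in the witness `A * R` pads it with zero
  -- columns outside `K`.
  let A : Matrix J {p // p ∈ K} ℝ := C.submatrix id Subtype.val * CK⁻¹
  have hA : A * CK = C.submatrix id Subtype.val :=
    Matrix.nonsing_inv_mul_cancel_right _ _ ((Matrix.isUnit_iff_isUnit_det _).1 hK.isUnit)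
  have hR : R * C = C.submatrix Subtype.val id := by
    ext p q
    simp [R, Matrix.mul_apply, Matrix.one_apply]
  refine ⟨A * R, fun p q hq => ?_, fun p q hq => ?_⟩
  · refine Finset.sum_eq_zero fun k _ => ?_
    have : (k : J) ≠ q := fun h => hq (h ▸ k.2)
    simp [R, this]
  · have h := congrFun (congrFun hA p) ⟨q, hq⟩
    rw [Matrix.sub_mul, Matrix.one_mul, Matrix.sub_apply, sub_eq_zero, Matrix.mul_assoc, hR]
    exact h.symm

/-- Vectors of a nonsingular Gaussian sequence are conditionally independent given the rest
exactly if the corresponding part of the inverse covariance matrix vanishes. -/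
lemma IsZMNG.condIndepGiven_iff (hx : IsZMNG μ x) {S K T : Set (Fin (N + 1))}
    (hSK : Disjoint S K) (hST : Disjoint S T) (hKT : Disjoint K T)
    (hU : ∀ i, i ∈ S ∨ i ∈ K ∨ i ∈ T) :
    CondIndepGiven μ (sigmaOf x K) (sigmaOf x S) (sigmaOf x T) ↔
      ∀ p q : Fin (N + 1) × Fin d, p.1 ∈ S → q.1 ∈ T → (covMatrix μ x)⁻¹ p q = 0 := by
  classical
  have hx' := hx.toIsZeroMeanGaussian
  have := hx'.isProbabilityMeasure
  have hle := sigmaOf_le hx.measurable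
  have hdet : IsUnit (covMatrix μ x).det :=
    (Matrix.isUnit_iff_isUnit_det _).1 hx.nonsingular.isUnit
  set C := covMatrix μ x with hC
  set P := C⁻¹ with hP
  rw [Set.disjoint_left] at hSK hST hKT
  have hsum : ∀ (f g : Fin (N + 1) × Fin d → ℝ), (∀ p, p.1 ∉ S → f p * g p = 0) →
      ∑ p, f p * g p = ∑ p : {p : Fin (N + 1) × Fin d // p.1 ∈ S}, f p * g p := by
    intro f g hf
    rw [← Fintype.sum_subtype_add_sum_subtype (fun p : Fin (N + 1) × Fin d => p.1 ∈ S)]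
    simp only [add_eq_left]
    exact Finset.sum_eq_zero fun p _ => hf p p.2
  let PS : Matrix {p : Fin (N + 1) × Fin d // p.1 ∈ S} {p : Fin (N + 1) × Fin d // p.1 ∈ S} ℝ :=
    P.submatrix Subtype.val Subtype.val
  constructor
  · intro h
    -- Lx is the residual of x_S after regression on x_K; it is uncorrelated with x_K and x_T, so LC
    -- lives on the columns in `S`. In L = (LC)P, with `D` the `S` part of LC, the columns in `S`
    -- give D P_SS = 1 and those in `T` give D P_ST = 0. Hence P_ST = 0.
    obtain ⟨A, hA, hAC⟩ := exists_regression hx.nonsingular {p | p.1 ∈ K}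
    let L : Matrix {p : Fin (N + 1) × Fin d // p.1 ∈ S} (Fin (N + 1) × Fin d) ℝ :=
      (1 - A).submatrix Subtype.val id
    have hLT := hx'.mul_covMatrix_eq_zero h (L := L)
      (fun i p hS hK => by
        have : (i : Fin (N + 1) × Fin d) ≠ p := fun h => hS (h ▸ i.2)
        simp [L, this, hA i p hK])
      (fun i p hp => hAC i p hp)
    have hLS : ∀ i p, p.1 ∉ S → (L * C) i p = 0 := by
      intro i p hp
      rcases hU p.1 with h | h | h
      · exact absurd h hp
      · exact hAC i p h
      · exact hLT i p h
    have hLP : L * C * P = L := Matrix.mul_nonsing_inv_cancel_right _ _ hdet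
    let D : Matrix {p : Fin (N + 1) × Fin d // p.1 ∈ S} {p : Fin (N + 1) × Fin d // p.1 ∈ S} ℝ :=
      (L * C).submatrix id Subtype.val
    have hD : ∀ i q, ∑ p : {p : Fin (N + 1) × Fin d // p.1 ∈ S}, D i p * P p q = L i q := by
      intro i q
      rw [← congrFun (congrFun hLP i) q, Matrix.mul_apply,
        hsum _ _ fun p hp => by rw [hLS i p hp, zero_mul]]
      rfl
    have hDP : D * PS = 1 := by
      ext i q
      refine (hD i q).trans ?_
      simp [L, hA i q (hSK q.2), Matrix.one_apply, Subtype.ext_iff]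
    intro p q hp hq
    have hv : D *ᵥ (fun p => P p q) = 0 := by
      ext i
      refine (hD i q).trans ?_
      have : (i : Fin (N + 1) × Fin d) ≠ q := fun h => hST i.2 (h ▸ hq)
      simp [L, hA i q fun h => hKT h hq, this]
    have hv' : (fun p : {p : Fin (N + 1) × Fin d // p.1 ∈ S} => P p q) = 0 := by
      rw [← Matrix.one_mulVec fun p : {p : Fin (N + 1) × Fin d // p.1 ∈ S} => P p q,
        ← mul_eq_one_comm.1 hDP, ← Matrix.mulVec_mulVec, hv, Matrix.mulVec_zero]
    exact congrFun hv' ⟨p, hp⟩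
  · intro h
    -- LC consists of the `S` rows of PC = 1, so Lx is independent of the states in `K ∪ T`. Since
    -- P_ST = 0, the part `M` of `L` outside `S` involves only `K`, and x_S = P_SS⁻¹(Lx - Mx) is a
    -- function of Lx and x_K.
    let L : Matrix {p : Fin (N + 1) × Fin d // p.1 ∈ S} (Fin (N + 1) × Fin d) ℝ :=
      P.submatrix Subtype.val id
    let M : Matrix {p : Fin (N + 1) × Fin d // p.1 ∈ S} (Fin (N + 1) × Fin d) ℝ :=
      Matrix.of fun i q => if q.1 ∈ S then 0 else L i q
    have hPS : IsUnit PS.det := (Matrix.isUnit_iff_isUnit_det _).1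
      (hx.nonsingular.inv.submatrix Subtype.val_injective).isUnit
    have hLC : ∀ i p, p.1 ∈ K ∪ T → (L * C) i p = 0 := by
      intro i p hp
      have h1 : (L * C) i p = (P * C) i p := rfl
      rw [h1, Matrix.nonsing_inv_mul _ hdet, Matrix.one_apply_ne]
      rintro rfl
      rcases hp with hp | hp
      · exact hSK i.2 hp
      · exact hST i.2 hp
    have hind := hx'.indep_sigmaOf hLC
    rw [sigmaOf_union] at hind
    have hLm : MeasurableSpace.comap (fun ω => L *ᵥ stack x ω) inferInstance ≤ mΩ :=
      measurable_iff_comap_le.1 <| measurable_mulVec_stack fun p =>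
        Or.inl ((measurable_stack_sigmaOf (Set.mem_univ p.1)).mono (hle _) le_rfl)
    refine ((condIndepGiven_of_indep_sup (hle _) hLm (hle _) hind).sup_left (hle _) hLm
      (hle _)).mono ?_ le_rfl
    have hX : ∀ ω, (fun p : {p : Fin (N + 1) × Fin d // p.1 ∈ S} => stack x ω p) =
        PS⁻¹ *ᵥ (L *ᵥ stack x ω - M *ᵥ stack x ω) := by
      intro ω
      have : L *ᵥ stack x ω - M *ᵥ stack x ω =
          PS *ᵥ fun p : {p : Fin (N + 1) × Fin d // p.1 ∈ S} => stack x ω p := by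
        rw [← Matrix.sub_mulVec]
        ext i
        simp only [Matrix.mulVec, dotProduct]
        rw [hsum _ _ fun p hp => by simp [M, hp]]
        refine Finset.sum_congr rfl fun p _ => ?_
        simp [M, L, PS, p.2]
      rw [this, Matrix.mulVec_mulVec, Matrix.nonsing_inv_mul _ hPS, Matrix.one_mulVec]
    have hM : Measurable[sigmaOf x K] fun ω => M *ᵥ stack x ω := by
      refine measurable_mulVec_stack fun p => ?_
      rcases hU p.1 with hp | hp | hp
      · exact Or.inr fun i => by simp [M, hp]
      · exact Or.inl (measurable_stack_sigmaOf hp)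
      · exact Or.inr fun i => by simp [M, L, h i p i.2 hp]
    rw [sigmaOf_le_iff]
    intro p hp
    have : (fun ω => stack x ω p) = fun ω =>
        ∑ i, PS⁻¹ ⟨p, hp⟩ i * ((L *ᵥ stack x ω) i - (M *ᵥ stack x ω) i) :=
      funext fun ω => congrFun (hX ω) ⟨p, hp⟩
    rw [this]
    refine Finset.measurable_sum _ fun i _ => Measurable.const_mul (Measurable.sub ?_ ?_) _
    · exact ((measurable_pi_apply i).comp (comap_measurable fun ω => L *ᵥ stack x ω)).mono
        le_sup_left le_rfl
    · exact ((measurable_pi_apply i).comp hM).mono le_sup_right le_rfl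

end Precision

/-! ### Block matrices -/

section Block

variable {n d : ℕ}

/-- The `(i, j)` block of a matrix indexed by times and coordinates. -/
def block (M : Matrix (Fin n × Fin d) (Fin n × Fin d) ℝ) (i j : Fin n) :
    Matrix (Fin d) (Fin d) ℝ :=
  Matrix.of fun a b => M (i, a) (j, b)

/-- The matrix with given blocks. -/
def ofBlocks (B : Fin n → Fin n → Matrix (Fin d) (Fin d) ℝ) :
    Matrix (Fin n × Fin d) (Fin n × Fin d) ℝ :=
  Matrix.of fun p q => B p.1 q.1 p.2 q.2

@[simp] lemma block_ofBlocks (B : Fin n → Fin n → Matrix (Fin d) (Fin d) ℝ) (i j : Fin n) :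
    block (ofBlocks B) i j = B i j := rfl

lemma block_mul (M M' : Matrix (Fin n × Fin d) (Fin n × Fin d) ℝ) (i j : Fin n) :
    block (M * M') i j = ∑ k, block M i k * block M' k j := by
  ext a b
  simp [block, Matrix.mul_apply, Matrix.sum_apply, Fintype.sum_prod_type]

lemma block_transpose (M : Matrix (Fin n × Fin d) (Fin n × Fin d) ℝ) (i j : Fin n) :
    block Mᵀ i j = (block M j i)ᵀ := rfl

lemma block_eq_zero_iff {M : Matrix (Fin n × Fin d) (Fin n × Fin d) ℝ} {i j : Fin n} :
    block M i j = 0 ↔ ∀ a b, M (i, a) (j, b) = 0 := by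
  simp [← Matrix.ext_iff, block]

lemma block_one (i j : Fin n) :
    block (1 : Matrix (Fin n × Fin d) (Fin n × Fin d) ℝ) i j = if i = j then 1 else 0 := by
  ext a b
  by_cases h : i = j <;> simp [block, Matrix.one_apply, h]

lemma block_ext {M M' : Matrix (Fin n × Fin d) (Fin n × Fin d) ℝ}
    (h : ∀ i j, block M i j = block M' i j) : M = M' := by
  ext p q
  exact congrFun (congrFun (h p.1 q.1) p.2) q.2

end Block

/-! ### Zero patterns of the Markov and reciprocal properties -/

section Pattern

variable {Ω : Type*} [mΩ : MeasurableSpace Ω] {μ : Measure Ω} {N d : ℕ}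
  {x : Fin (N + 1) → Ω → Fin d → ℝ}

/-- The `(i, j)` block of the inverse of the covariance matrix. -/
noncomputable def precision (μ : Measure Ω) (x : Fin (N + 1) → Ω → Fin d → ℝ) (i j : Fin (N + 1)) :
    Matrix (Fin d) (Fin d) ℝ :=
  block (covMatrix μ x)⁻¹ i j

lemma IsZMNG.precision_transpose (hx : IsZMNG μ x) (i j : Fin (N + 1)) :
    (precision μ x i j)ᵀ = precision μ x j i := by
  have h : (covMatrix μ x)⁻¹ᵀ = (covMatrix μ x)⁻¹ := by
    simpa [Matrix.IsHermitian] using hx.nonsingular.inv.isHermitian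
  rw [precision, ← block_transpose, h, precision]

lemma IsZMNG.condIndepGiven_iff_precision (hx : IsZMNG μ x) {S K T : Set (Fin (N + 1))}
    (hSK : Disjoint S K) (hST : Disjoint S T) (hKT : Disjoint K T)
    (hU : ∀ i, i ∈ S ∨ i ∈ K ∨ i ∈ T) :
    CondIndepGiven μ (sigmaOf x K) (sigmaOf x S) (sigmaOf x T) ↔
      ∀ i ∈ S, ∀ j ∈ T, precision μ x i j = 0 := by
  rw [hx.condIndepGiven_iff hSK hST hKT hU]
  simp only [precision, block_eq_zero_iff, Prod.forall]
  exact ⟨fun h i hi j hj a b => h i a j b hi hj, fun h i a j b hi hj => h i hi j hj a b⟩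

/-- A nonsingular Gaussian sequence is Markov iff its inverse covariance matrix is block
tridiagonal. -/
lemma IsZMNG.isMarkov_iff (hx : IsZMNG μ x) :
    IsMarkov μ x ↔ ∀ i j : Fin (N + 1), (i : ℕ) + 1 < j → precision μ x i j = 0 := by
  have h (k : Fin (N + 1)) := hx.condIndepGiven_iff_precision (S := {i | i < k}) (K := {k})
    (T := {i | k < i}) (by simp) (by simp [Set.disjoint_left]; grind) (by simp)
    (by intro i; simp; grind)
  simp only [IsMarkov, h, Set.mem_ofPred_eq]
  constructor
  · intro H i j hij
    -- The time i + 1 lies strictly between i and j.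
    exact H ⟨i + 1, by omega⟩ i (by simp [Fin.lt_def]) j (by simpa [Fin.lt_def] using hij)
  · intro H k i hi j hj
    exact H i j (by rw [Fin.lt_def] at hi hj; omega)

/-- A nonsingular Gaussian sequence is reciprocal iff its inverse covariance matrix is cyclic block
tridiagonal. -/
lemma IsZMNG.isReciprocal_iff (hx : IsZMNG μ x) :
    IsReciprocal μ x ↔ ∀ i j : Fin (N + 1), (i : ℕ) + 1 < j → ¬ ((i : ℕ) = 0 ∧ (j : ℕ) = N) →
      precision μ x i j = 0 := by
  have h (k₁ k₂ : Fin (N + 1)) (hk : k₁ < k₂) := hx.condIndepGiven_iff_precision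
    (S := {i | k₁ < i ∧ i < k₂}) (K := {k₁, k₂}) (T := {i | i < k₁ ∨ k₂ < i})
    (by simp [Set.disjoint_left]; grind) (by simp [Set.disjoint_left]; grind)
    (by simp [Set.disjoint_left]; grind) (by intro i; simp; grind)
  have h' : IsReciprocal μ x ↔ ∀ k₁ k₂ : Fin (N + 1), k₁ < k₂ →
      ∀ i ∈ {i | k₁ < i ∧ i < k₂}, ∀ j ∈ {i | i < k₁ ∨ k₂ < i}, precision μ x i j = 0 :=
    forall₂_congr fun k₁ k₂ => forall_congr' fun hk => h k₁ k₂ hk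
  rw [h']
  simp only [Set.mem_ofPred_eq, Fin.lt_def]
  constructor
  · intro H i j hij hne
    -- An interior index is isolated by its two neighbours. If i = 0, then j is interior because the
    -- corner is excluded, and j is isolated instead.
    by_cases hi : (i : ℕ) = 0
    · rw [← hx.precision_transpose, H ⟨j - 1, by omega⟩ ⟨j + 1, by omega⟩ (by dsimp only; omega) j
        (by dsimp only; omega) i (by dsimp only; omega), Matrix.transpose_zero]
    · exact H ⟨i - 1, by omega⟩ ⟨i + 1, by omega⟩ (by dsimp only; omega) i
        (by dsimp only; omega) j (by dsimp only; omega)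
  · intro H k₁ k₂ hk i hi j hj
    rcases hj with hj | hj
    · rw [← hx.precision_transpose, H j i (by omega) (by omega), Matrix.transpose_zero]
    · exact H i j (by omega) (by omega)

end Pattern

/-! ### The inverse covariance matrix of a linear model -/

section Model

variable {Ω : Type*} {N d : ℕ} {x e : Fin (N + 1) → Ω → Fin d → ℝ}

lemma stack_mulVec_ofBlocks (B : Fin (N + 1) → Fin (N + 1) → Matrix (Fin d) (Fin d) ℝ) (ω : Ω)
    (k : Fin (N + 1)) (a : Fin d) :
    (ofBlocks B *ᵥ stack x ω) (k, a) = (∑ j, B k j *ᵥ x j ω) a := by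
  simp [Matrix.mulVec, dotProduct, Fintype.sum_prod_type, ofBlocks, stack, Finset.sum_apply]

lemma sum_ite_mulVec {ι : Type*} [Fintype ι] [DecidableEq ι] (a : ι)
    (M : ι → Matrix (Fin d) (Fin d) ℝ) (v : ι → Fin d → ℝ) :
    ∑ j, (if j = a then M j else 0) *ᵥ v j = M a *ᵥ v a := by
  rw [Finset.sum_eq_single a (fun j _ hj => by simp [hj]) (by simp)]
  simp

variable [mΩ : MeasurableSpace Ω] {μ : Measure Ω}

lemma covariance_congr_ae {X X' Y Y' : Ω → ℝ} (hX : X =ᵐ[μ] X') (hY : Y =ᵐ[μ] Y') :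
    cov[X, Y; μ] = cov[X', Y'; μ] := by
  simp only [covariance, integral_congr_ae hX, integral_congr_ae hY]
  refine integral_congr_ae ?_
  filter_upwards [hX, hY] with ω h1 h2
  rw [h1, h2]

/-- The inverse covariance matrix of a sequence with the linear model `x_k = ∑ B_{k,j} x_j + e_k`
driven by white noise `e`. -/
lemma IsZeroMeanGaussian.precision_eq (hx : IsZeroMeanGaussian μ x)
    {Q : Fin (N + 1) → Matrix (Fin d) (Fin d) ℝ}
    (he : IsWhiteGaussian μ e Q) {B : Fin (N + 1) → Fin (N + 1) → Matrix (Fin d) (Fin d) ℝ}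
    (h : ∀ k, ∀ᵐ ω ∂μ, x k ω = ∑ j, B k j *ᵥ x j ω + e k ω) (i j : Fin (N + 1)) :
    precision μ x i j = ∑ k, ((if k = i then 1 else 0) - B k i)ᵀ * (Q k)⁻¹ *
      ((if k = j then 1 else 0) - B k j) := by
  have hμ := hx.isProbabilityMeasure
  set C := covMatrix μ x with hC
  let L : Matrix (Fin (N + 1) × Fin d) (Fin (N + 1) × Fin d) ℝ := 1 - ofBlocks B
  let D := ofBlocks fun k l : Fin (N + 1) => if k = l then Q k else 0
  let E := ofBlocks fun k l : Fin (N + 1) => if k = l then (Q k)⁻¹ else 0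
  have hLb : ∀ k l, block L k l = (if k = l then 1 else 0) - B k l := fun k l => by
    rw [← block_one]; rfl
  have hLe : ∀ p : Fin (N + 1) × Fin d, (fun ω => (L *ᵥ stack x ω) p) =ᵐ[μ] fun ω => e p.1 ω p.2 := by
    intro p
    filter_upwards [h p.1] with ω hω
    have h1 := congrFun hω p.2
    rw [Pi.add_apply, ← stack_mulVec_ofBlocks (x := x) B ω] at h1
    simp only [L, Matrix.sub_mulVec, Matrix.one_mulVec, Pi.sub_apply]
    rw [sub_eq_iff_eq_add, add_comm]
    exact h1
  have hcov : L * C * Lᵀ = D := by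
    ext p q
    rw [← hx.cov_mulVec, covariance_congr_ae (hLe p) (hLe q)]
    change covFun μ e p.1 q.1 p.2 q.2 = _
    by_cases hpq : p.1 = q.1
    · simp [D, ofBlocks, ← hpq, he.cov_eq]
    · simp [D, ofBlocks, hpq, he.white _ _ hpq]
  have hDE : D * E = 1 := by
    refine block_ext fun k l => ?_
    rw [block_mul, block_one]
    simp only [D, E, block_ofBlocks, ite_mul, zero_mul, mul_ite, mul_zero]
    rw [Finset.sum_eq_single k (fun m _ hm => by simp [hm.symm]) (by simp)]
    simp only [if_true]
    split_ifs with hkl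
    · exact Matrix.mul_nonsing_inv _
        ((Matrix.isUnit_iff_isUnit_det _).1 (he.nonsingular k).isUnit)
    · rfl
  -- From L C L' = D, the square matrix `L` has the right inverse C L' E, which is then also a left
  -- inverse; regrouping gives the inverse of `C`.
  have hinv : C * (Lᵀ * E * L) = 1 := by
    have h1 : L * (C * Lᵀ * E) = 1 := by rw [← hDE, ← hcov]; simp only [Matrix.mul_assoc]
    rw [← mul_eq_one_comm.1 h1]; simp only [Matrix.mul_assoc]
  rw [precision, Matrix.inv_eq_right_inv hinv, block_mul]
  refine Finset.sum_congr rfl fun k _ => ?_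
  rw [block_mul, hLb]
  congr 1
  simp only [E, block_ofBlocks, mul_ite, mul_zero, Finset.sum_ite_eq', Finset.mem_univ, if_true,
    block_transpose, hLb]

/-- The coefficients of the forward `CM_c` model with its boundary condition: the state at time `k`
is `∑ⱼ modelCoeff c b G k j * x_j + e_k`. -/
noncomputable def modelCoeff (c : Fin (N + 1)) (b : BoundaryForm)
    (G : Fin (N + 1) → Fin (N + 1) → Matrix (Fin d) (Fin d) ℝ) (k j : Fin (N + 1)) :
    Matrix (Fin d) (Fin d) ℝ :=
  if k ≠ 0 ∧ k ≠ c then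
    -- For c = 0, k = 1, j = 0 both terms are present and the coefficient is 2 G_{1,0}, as in
    -- `ForwardModel`.
    (if (j : ℕ) + 1 = k then G k j else 0) + (if j = c then G k j else 0)
  else if c = 0 then 0
  else match b with
    | .startFirst => if k = c ∧ j = 0 then G k j else 0
    | .condFirst => if k = 0 ∧ j = c then G k j else 0

lemma forwardModel_and_boundary_iff (hN : 0 < N) {c : Fin (N + 1)} (hc : c = 0 ∨ c = Fin.last N)
    (b : BoundaryForm) (G : Fin (N + 1) → Fin (N + 1) → Matrix (Fin d) (Fin d) ℝ) :
    (ForwardModel μ c x e G ∧ Boundary μ c x e G b) ↔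
      ∀ k, ∀ᵐ ω ∂μ, x k ω = ∑ j, modelCoeff c b G k j *ᵥ x j ω + e k ω := by
  have hN0 : Fin.last N ≠ 0 := by simp [Fin.ext_iff]; omega
  have hint : ∀ i : Fin N, i.succ ≠ c → ∀ ω, ∑ j, modelCoeff c b G i.succ j *ᵥ x j ω =
      G i.succ i.castSucc *ᵥ x i.castSucc ω + G i.succ c *ᵥ x c ω := by
    intro i hi ω
    have h1 : ∀ j : Fin (N + 1), (j : ℕ) = i ↔ j = i.castSucc := fun j => by simp [Fin.ext_iff]
    have h2 : ∀ j, modelCoeff c b G i.succ j = (if j = i.castSucc then G i.succ j else 0) +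
        (if j = c then G i.succ j else 0) := fun j => by
      simp [modelCoeff, hi, Fin.succ_ne_zero, h1]
    simp only [h2, Matrix.add_mulVec, Finset.sum_add_distrib, sum_ite_mulVec]
  have hfwd : ForwardModel μ c x e G ↔ ∀ k : Fin (N + 1), k ≠ 0 → k ≠ c →
      ∀ᵐ ω ∂μ, x k ω = ∑ j, modelCoeff c b G k j *ᵥ x j ω + e k ω := by
    constructor
    · intro h k hk0 hkc
      obtain ⟨i, rfl⟩ := Fin.exists_succ_eq.2 hk0
      filter_upwards [h i hkc] with ω hω
      rw [hω, hint i hkc]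
    · intro h i hi
      filter_upwards [h i.succ (Fin.succ_ne_zero i) hi] with ω hω
      rw [hω, hint i hi]
  have hbdry : Boundary μ c x e G b ↔ ∀ k : Fin (N + 1), (k = 0 ∨ k = c) →
      ∀ᵐ ω ∂μ, x k ω = ∑ j, modelCoeff c b G k j *ᵥ x j ω + e k ω := by
    rcases hc with rfl | rfl
    · have h0 : ∀ j, modelCoeff 0 b G 0 j = 0 := fun j => by simp [modelCoeff]
      cases b <;> simp [Boundary, hN0.symm, h0]
    · have h3 : ∀ j, modelCoeff (Fin.last N) .startFirst G 0 j = 0 := fun j => by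
        simp [modelCoeff, hN0, hN0.symm]
      have h4 : ∀ j, modelCoeff (Fin.last N) .startFirst G (Fin.last N) j =
          if j = 0 then G (Fin.last N) j else 0 := fun j => by simp [modelCoeff, hN0]
      have h5 : ∀ j, modelCoeff (Fin.last N) .condFirst G (Fin.last N) j = 0 := fun j => by
        simp [modelCoeff, hN0]
      have h6 : ∀ j, modelCoeff (Fin.last N) .condFirst G 0 j =
          if j = Fin.last N then G 0 j else 0 := fun j => by simp [modelCoeff, hN0]
      cases b
      · simp only [Boundary, forall_eq_or_imp, forall_eq, h3, h4, sum_ite_mulVec]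
        simp
      · simp only [Boundary, forall_eq_or_imp, forall_eq, h5, h6, sum_ite_mulVec]
        simp [and_comm]
  rw [hfwd, hbdry]
  constructor
  · rintro ⟨h1, h2⟩ k
    by_cases hk : k = 0 ∨ k = c
    · exact h2 k hk
    · push Not at hk
      exact h1 k hk.1 hk.2
  · exact fun h => ⟨fun k _ _ => h k, fun k _ => h k⟩

lemma governedBy_iff (hN : 0 < N) {c : Fin (N + 1)} (hc : c = 0 ∨ c = Fin.last N)
    (b : BoundaryForm) (G : Fin (N + 1) → Fin (N + 1) → Matrix (Fin d) (Fin d) ℝ)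
    (Q : Fin (N + 1) → Matrix (Fin d) (Fin d) ℝ) :
    GovernedBy μ c b x G Q ↔ ∃ e : Fin (N + 1) → Ω → Fin d → ℝ, IsWhiteGaussian μ e Q ∧
      ∀ k, ∀ᵐ ω ∂μ, x k ω = ∑ j, modelCoeff c b G k j *ᵥ x j ω + e k ω :=
  exists_congr fun _ => and_congr_right fun _ => forwardModel_and_boundary_iff hN hc b G

end Model

/-! ### Blocks of the inverse covariance matrix of a CM_c model -/

section Entries

variable {Ω : Type*} [mΩ : MeasurableSpace Ω] {μ : Measure Ω} {N d : ℕ}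
  {x : Fin (N + 1) → Ω → Fin d → ℝ} {c : Fin (N + 1)} {b : BoundaryForm}
  {G : Fin (N + 1) → Fin (N + 1) → Matrix (Fin d) (Fin d) ℝ}
  {Q : Fin (N + 1) → Matrix (Fin d) (Fin d) ℝ}

/-- The coefficient of `x_j` in the expression of the noise `e_k` by the states. -/
noncomputable def noiseCoeff (c : Fin (N + 1)) (b : BoundaryForm)
    (G : Fin (N + 1) → Fin (N + 1) → Matrix (Fin d) (Fin d) ℝ) (k j : Fin (N + 1)) :
    Matrix (Fin d) (Fin d) ℝ :=
  (if k = j then 1 else 0) - modelCoeff c b G k j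

lemma GovernedBy.precision_eq (hN : 0 < N) (hx : IsZMNG μ x) (hc : c = 0 ∨ c = Fin.last N)
    (h : GovernedBy μ c b x G Q) (i j : Fin (N + 1)) :
    precision μ x i j = ∑ k, (noiseCoeff c b G k i)ᵀ * (Q k)⁻¹ * noiseCoeff c b G k j := by
  obtain ⟨e, he, h⟩ := (governedBy_iff hN hc b G Q).1 h
  exact hx.toIsZeroMeanGaussian.precision_eq he h i j

lemma GovernedBy.posDef (h : GovernedBy μ c b x G Q) (k : Fin (N + 1)) : (Q k).PosDef := by
  obtain ⟨e, he, -⟩ := h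
  exact he.nonsingular k

lemma GovernedBy.transpose_inv (h : GovernedBy μ c b x G Q) (k : Fin (N + 1)) :
    (Q k)⁻¹ᵀ = (Q k)⁻¹ := by
  simpa [Matrix.IsHermitian] using (h.posDef k).inv.isHermitian

-- Row N obeys the boundary condition instead of the recursion, hence the restriction k < N in the
-- second case.
open scoped Classical in
lemma noiseCoeff_last (hN : 2 ≤ N) (k i : Fin (N + 1)) (hi : (i : ℕ) < N) :
    noiseCoeff (Fin.last N) b G k i = if (k : ℕ) = i then 1
      else if (k : ℕ) = i + 1 ∧ (k : ℕ) < N then -G k i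
      else if (k : ℕ) = N ∧ (i : ℕ) = 0 ∧ b = .startFirst then -G k i else 0 := by
  cases b <;> simp only [noiseCoeff, modelCoeff, Fin.ext_iff, Fin.val_last, Fin.val_zero, ne_eq,
    reduceCtorEq, and_true, and_false] <;> split_ifs <;>
    first | (exfalso; omega) | simp

open scoped Classical in
lemma noiseCoeff_last_last (hN : 2 ≤ N) (k : Fin (N + 1)) :
    noiseCoeff (Fin.last N) b G k (Fin.last N) = if (k : ℕ) = N then 1
      else if 0 < (k : ℕ) ∨ b = .condFirst then -G k (Fin.last N) else 0 := by
  cases b <;> simp only [noiseCoeff, modelCoeff, Fin.ext_iff, Fin.val_last, Fin.val_zero, ne_eq,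
    reduceCtorEq, or_false, or_true, and_true] <;> split_ifs <;>
    first | (exfalso; omega) | simp

lemma noiseCoeff_zero (k i : Fin (N + 1)) (hi : 0 < (i : ℕ)) :
    noiseCoeff 0 b G k i = if (k : ℕ) = i then 1 else if (k : ℕ) = i + 1 then -G k i else 0 := by
  simp only [noiseCoeff, modelCoeff, Fin.ext_iff, Fin.val_zero, ne_eq]
  split_ifs <;>
    first | (exfalso; omega) | simp

/-- The bound leaves out the doubled coefficient at k = 1, which does not enter the blocks (0, j)
with j ≥ 2. -/
lemma noiseCoeff_zero_zero (k : Fin (N + 1)) (hk : 1 < (k : ℕ)) :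
    noiseCoeff 0 b G k 0 = -G k 0 := by
  simp only [noiseCoeff, modelCoeff, Fin.ext_iff, Fin.val_zero, ne_eq, zero_add, hk.ne]
  split_ifs <;> first | (exfalso; omega) | simp

/-- Columns i and j of 1 - B have no common nonzero row: column j lives on rows j and j + 1, column
i on i and i + 1, and also on row N if i = 0. -/
lemma precision_last_of_lt (hN : 2 ≤ N) (hx : IsZMNG μ x)
    (h : GovernedBy μ (Fin.last N) b x G Q) {i j : Fin (N + 1)} (hij : (i : ℕ) + 1 < j)
    (hj : (j : ℕ) < N) : precision μ x i j = 0 := by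
  rw [h.precision_eq (by omega) hx (.inr rfl)]
  refine Finset.sum_eq_zero fun k _ => ?_
  rw [noiseCoeff_last hN k i (by omega), noiseCoeff_last hN k j hj]
  split_ifs <;> first | (exfalso; omega) | simp

/-- Since i > 0, column i of 1 - B is nonzero only in rows i and i + 1. -/
lemma precision_last_interior (hN : 2 ≤ N) (hx : IsZMNG μ x)
    (h : GovernedBy μ (Fin.last N) b x G Q) (i : Fin N) (hi : 0 < (i : ℕ)) (hi' : (i : ℕ) + 1 < N) :
    precision μ x i.castSucc (Fin.last N) = (G i.succ i.castSucc)ᵀ * (Q i.succ)⁻¹ *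
      G i.succ (Fin.last N) - (Q i.castSucc)⁻¹ * G i.castSucc (Fin.last N) := by
  rw [h.precision_eq (by omega) hx (.inr rfl),
    Fintype.sum_eq_add i.succ i.castSucc (by simp [Fin.ext_iff])]
  · simp only [noiseCoeff_last hN _ i.castSucc (by simp), noiseCoeff_last_last hN, Fin.val_succ,
      Fin.val_castSucc]
    simp [hi, hi', i.2.ne, hi'.ne, sub_eq_add_neg]
  · rintro k ⟨h1, h2⟩
    simp only [ne_eq, Fin.ext_iff, Fin.val_succ, Fin.val_castSucc] at h1 h2
    rw [noiseCoeff_last hN _ i.castSucc (by simp)]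
    simp [h1, h2, hi.ne']

/-- Column 0 lives on rows 0, 1 and N, but with this boundary form row 0 has no entry in column N.
-/
lemma precision_last_startFirst (hN : 2 ≤ N) (hx : IsZMNG μ x)
    (h : GovernedBy μ (Fin.last N) .startFirst x G Q) :
    precision μ x 0 (Fin.last N) = (G 1 0)ᵀ * (Q 1)⁻¹ * G 1 (Fin.last N) -
      (G (Fin.last N) 0)ᵀ * (Q (Fin.last N))⁻¹ := by
  have h1 : ((1 : Fin (N + 1)) : ℕ) = 1 := by rw [Fin.val_one', Nat.mod_eq_of_lt]; omega
  rw [h.precision_eq (by omega) hx (.inr rfl),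
    Fintype.sum_eq_add 1 (Fin.last N) (by rw [Ne, Fin.ext_iff, h1, Fin.val_last]; omega)]
  · simp only [noiseCoeff_last hN _ 0 (by simp; omega), noiseCoeff_last_last hN, h1, Fin.val_last, zero_lt_one, true_or,
      if_true]
    have h2 : 1 ≠ N := by omega
    have h3 : N ≠ 0 := by omega
    have h4 : 1 < N := by omega
    simp [h2, h3, h4, sub_eq_add_neg, -Fin.val_one]
  · rintro k ⟨h2, h3⟩
    simp only [ne_eq, Fin.ext_iff, h1, Fin.val_last] at h2 h3
    rw [noiseCoeff_last hN _ 0 (by simp; omega), noiseCoeff_last_last hN]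
    by_cases hk : (k : ℕ) = 0 <;> simp [hk, h2, h3]
    omega

lemma precision_last_condFirst (hN : 2 ≤ N) (hx : IsZMNG μ x)
    (h : GovernedBy μ (Fin.last N) .condFirst x G Q) :
    precision μ x 0 (Fin.last N) = (G 1 0)ᵀ * (Q 1)⁻¹ * G 1 (Fin.last N) -
      (Q 0)⁻¹ * G 0 (Fin.last N) := by
  have h1 : ((1 : Fin (N + 1)) : ℕ) = 1 := by rw [Fin.val_one', Nat.mod_eq_of_lt]; omega
  rw [h.precision_eq (by omega) hx (.inr rfl),
    Fintype.sum_eq_add 1 0 (by rw [Ne, Fin.ext_iff, h1, Fin.val_zero]; omega)]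
  · simp only [noiseCoeff_last hN _ 0 (by simp; omega), noiseCoeff_last_last hN, h1, Fin.val_zero]
    have h2 : 1 ≠ N := by omega
    have h3 : 0 ≠ N := by omega
    have h4 : 1 < N := by omega
    simp [h2, h3, h4, sub_eq_add_neg, -Fin.val_one]
  · rintro k ⟨h2, h3⟩
    simp only [ne_eq, Fin.ext_iff, h1, Fin.val_zero] at h2 h3
    rw [noiseCoeff_last hN _ 0 (by simp; omega)]
    simp [h2, h3]

lemma precision_zero_of_pos (hN : 2 ≤ N) (hx : IsZMNG μ x)
    (h : GovernedBy μ 0 b x G Q) {i j : Fin (N + 1)} (hij : (i : ℕ) + 1 < j)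
    (hi : 0 < (i : ℕ)) : precision μ x i j = 0 := by
  rw [h.precision_eq (by omega) hx (.inl rfl)]
  refine Finset.sum_eq_zero fun k _ => ?_
  rw [noiseCoeff_zero k i hi, noiseCoeff_zero k j (by omega)]
  split_ifs <;> first | (exfalso; omega) | simp

lemma precision_zero_interior (hN : 2 ≤ N) (hx : IsZMNG μ x)
    (h : GovernedBy μ 0 b x G Q) (i : Fin N) (hi : 1 < (i : ℕ)) :
    precision μ x 0 i.castSucc = (G i.succ 0)ᵀ * (Q i.succ)⁻¹ * G i.succ i.castSucc -
      (G i.castSucc 0)ᵀ * (Q i.castSucc)⁻¹ := by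
  rw [h.precision_eq (by omega) hx (.inl rfl),
    Fintype.sum_eq_add i.succ i.castSucc (by simp [Fin.ext_iff])]
  · rw [noiseCoeff_zero_zero i.succ (by simp; omega), noiseCoeff_zero_zero i.castSucc (by simpa),
      noiseCoeff_zero _ _ (by simp; omega), noiseCoeff_zero _ _ (by simp; omega)]
    simp [sub_eq_add_neg]
  · rintro k ⟨h1, h2⟩
    simp only [ne_eq, Fin.ext_iff, Fin.val_succ, Fin.val_castSucc] at h1 h2
    rw [noiseCoeff_zero _ i.castSucc (by simp; omega)]
    simp [h1, h2]

lemma precision_zero_last (hN : 2 ≤ N) (hx : IsZMNG μ x) (h : GovernedBy μ 0 b x G Q) :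
    precision μ x 0 (Fin.last N) = -((G (Fin.last N) 0)ᵀ * (Q (Fin.last N))⁻¹) := by
  rw [h.precision_eq (by omega) hx (.inl rfl), Fintype.sum_eq_single (Fin.last N)]
  · rw [noiseCoeff_zero_zero _ (by simp; omega), noiseCoeff_zero _ _ (by simp; omega)]
    simp
  · intro k hk
    rw [noiseCoeff_zero _ (Fin.last N) (by simp; omega)]
    rw [Ne, Fin.ext_iff, Fin.val_last] at hk
    have := k.2
    have : (k : ℕ) ≠ N + 1 := by omega
    simp [hk, this]

/-- Some block formulas are transposed relative to the stated conditions; this converts between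
them, using the symmetry of the inverse noise covariances. -/
lemma transpose_inv_mul_sub_eq_zero_iff {A B C E F : Matrix (Fin d) (Fin d) ℝ} (hA : Aᵀ = A)
    (hE : Eᵀ = E) : Fᵀ * E * C - Bᵀ * A = 0 ↔ A * B = Cᵀ * E * F := by
  rw [← Matrix.transpose_eq_zero]
  simp only [Matrix.transpose_sub, Matrix.transpose_mul, Matrix.transpose_transpose, hA, hE]
  rw [sub_eq_zero, eq_comm, Matrix.mul_assoc]

/-- The precision characterization of the reciprocal property in terms of the model parameters. -/
lemma GovernedBy.isReciprocal_iff (hN : 2 ≤ N) (hx : IsZMNG μ x) (hc : c = 0 ∨ c = Fin.last N)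
    (h : GovernedBy μ c b x G Q) : IsReciprocal μ x ↔ ReciprocalCondition c G Q := by
  rw [hx.isReciprocal_iff]
  rcases hc with rfl | rfl
  · have hN0 : (0 : Fin (N + 1)) ≠ Fin.last N := by simp [Fin.ext_iff]; omega
    constructor
    · rintro H i (⟨hi, -⟩ | ⟨-, hi, hi'⟩)
      · exact absurd hi hN0
      · rw [← transpose_inv_mul_sub_eq_zero_iff (h.transpose_inv _) (h.transpose_inv _),
          ← precision_zero_interior hN hx h i hi]
        exact H _ _ (by simpa) (by simp; omega)
    · intro H i j hij hne
      by_cases hi : (i : ℕ) = 0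
      · obtain rfl : i = 0 := Fin.ext hi
        have hj : (j : ℕ) < N := by have := j.2; rw [Fin.val_zero] at hne; omega
        have := precision_zero_interior hN hx h ⟨j, hj⟩ (by simpa using hij)
        exact this.trans ((transpose_inv_mul_sub_eq_zero_iff (h.transpose_inv _)
          (h.transpose_inv _)).2 (H _ (.inr ⟨rfl, by simpa using hij, hj⟩)))
      · exact precision_zero_of_pos hN hx h hij (by omega)
  · have hN0 : Fin.last N ≠ 0 := by simp [Fin.ext_iff]; omega
    constructor
    · rintro H i (⟨-, hi, hi'⟩ | ⟨hi, -⟩)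
      · rw [eq_comm, ← sub_eq_zero, ← precision_last_interior hN hx h i hi hi']
        exact H _ _ (by simpa) (by simp; omega)
      · exact absurd hi hN0
    · intro H i j hij hne
      by_cases hj : (j : ℕ) = N
      · obtain rfl : j = Fin.last N := Fin.ext hj
        rw [Fin.val_last] at hij
        have := precision_last_interior hN hx h ⟨i, by omega⟩ (by dsimp only; omega) hij
        refine this.trans ?_
        rw [sub_eq_zero, eq_comm]
        exact H _ (.inl ⟨rfl, by dsimp only; omega, hij⟩)
      · exact precision_last_of_lt hN hx h hij (by omega)

/-- The left side does not involve the parameters, so the condition holds for all models of the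
sequence or for none. -/
lemma GovernedBy.precision_zero_last_eq_zero_iff (hN : 2 ≤ N) (hx : IsZMNG μ x)
    (hc : c = 0 ∨ c = Fin.last N) (h : GovernedBy μ c b x G Q) :
    precision μ x 0 (Fin.last N) = 0 ↔ MarkovCondition c b G Q := by
  rcases hc with rfl | rfl
  · have hN0 : (0 : Fin (N + 1)) ≠ Fin.last N := by simp [Fin.ext_iff]; omega
    rw [precision_zero_last hN hx h]
    simp only [MarkovCondition, hN0, false_imp_iff, true_and, true_imp_iff, neg_eq_zero]
    constructor
    · intro h0
      have : (G (Fin.last N) 0)ᵀ * (Q (Fin.last N))⁻¹ * Q (Fin.last N) = 0 * Q (Fin.last N) := by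
        rw [h0]
      rw [Matrix.nonsing_inv_mul_cancel_right _ _
        ((Matrix.isUnit_iff_isUnit_det _).1 (h.posDef _).isUnit), Matrix.zero_mul] at this
      simpa using this
    · intro h0; simp [h0]
  · have hN0 : Fin.last N ≠ 0 := by simp [Fin.ext_iff]; omega
    cases b
    · simp only [MarkovCondition, hN0, false_imp_iff, and_true, true_imp_iff]
      rw [precision_last_startFirst hN hx h,
        transpose_inv_mul_sub_eq_zero_iff (h.transpose_inv _) (h.transpose_inv _)]
    · simp only [MarkovCondition, hN0, false_imp_iff, and_true, true_imp_iff]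
      rw [precision_last_condFirst hN hx h, sub_eq_zero, eq_comm]

/-- The tridiagonal pattern is the cyclic one together with a vanishing corner. -/
lemma GovernedBy.isMarkov_iff (hN : 2 ≤ N) (hx : IsZMNG μ x) (hc : c = 0 ∨ c = Fin.last N)
    (h : GovernedBy μ c b x G Q) :
    IsMarkov μ x ↔ ReciprocalCondition c G Q ∧ MarkovCondition c b G Q := by
  rw [← h.isReciprocal_iff hN hx hc, ← h.precision_zero_last_eq_zero_iff hN hx hc,
    hx.isMarkov_iff, hx.isReciprocal_iff]
  constructor
  · exact fun H => ⟨fun i j hij _ => H i j hij, H _ _ (by simp; omega)⟩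
  · rintro ⟨H, H'⟩ i j hij
    by_cases hne : (i : ℕ) = 0 ∧ (j : ℕ) = N
    · obtain rfl : i = 0 := Fin.ext hne.1
      obtain rfl : j = Fin.last N := Fin.ext hne.2
      exact H'
    · exact H i j hij hne

end Entries

/-! ### Existence of a model by successive regression -/

section Existence

variable {Ω : Type*} [mΩ : MeasurableSpace Ω] {μ : Measure Ω} {N d : ℕ}
  {x : Fin (N + 1) → Ω → Fin d → ℝ}

lemma IsZeroMeanGaussian.integral_stack (hx : IsZeroMeanGaussian μ x) :
    ∫ ω, stack x ω ∂μ = 0 := by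
  have hμ := hx.isProbabilityMeasure
  ext p
  rw [eval_integral fun q => (hx.memLp_stack q).integrable one_le_two]
  have h := congrFun (hx.mean_zero p.1) p.2
  rw [eval_integral (f := x p.1)
    fun a => (hx.memLp_stack (p.1, a)).integrable one_le_two] at h
  exact h

/-- The sequence of linear combinations of the states with the rows of `L` as coefficients. -/
def linearSeq (L : Matrix (Fin (N + 1) × Fin d) (Fin (N + 1) × Fin d) ℝ)
    (x : Fin (N + 1) → Ω → Fin d → ℝ) (k : Fin (N + 1)) (ω : Ω) (a : Fin d) : ℝ :=
  (L *ᵥ stack x ω) (k, a)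

lemma IsZeroMeanGaussian.linearSeq (hx : IsZeroMeanGaussian μ x)
    (L : Matrix (Fin (N + 1) × Fin d) (Fin (N + 1) × Fin d) ℝ) :
    IsZeroMeanGaussian μ (linearSeq L x) where
  measurable k := by
    have h : Measurable fun ω => L *ᵥ stack x ω := measurable_mulVec_stack fun p =>
      .inl ((measurable_pi_apply p.2).comp (hx.measurable p.1))
    exact measurable_pi_lambda _ fun a => (measurable_pi_apply (k, a)).comp h
  gaussian := by
    let Φ : (Fin (N + 1) × Fin d → ℝ) →L[ℝ] (Fin (N + 1) → Fin d → ℝ) :=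
      ContinuousLinearMap.pi fun k => ContinuousLinearMap.pi fun a =>
        ContinuousLinearMap.proj (R := ℝ) (φ := fun _ : Fin (N + 1) × Fin d => ℝ) (k, a)
    exact (hx.hasGaussianLaw_mulVec L).map_fun Φ
  mean_zero k := by
    have hμ := hx.isProbabilityMeasure
    ext a
    rw [eval_integral (f := GaussSeq.linearSeq L x k)
      fun b => (hx.memLp_mulVec L (k, b)).integrable one_le_two]
    let Φ : (Fin (N + 1) × Fin d → ℝ) →L[ℝ] ℝ :=
      (ContinuousLinearMap.proj (R := ℝ) (φ := fun _ : Fin (N + 1) × Fin d => ℝ) (k, a)).comp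
        (LinearMap.toContinuousLinearMap (Matrix.mulVecLin L))
    have := Φ.integral_comp_comm hx.hasGaussianLaw_stack.integrable
    rw [hx.integral_stack, map_zero] at this
    exact this

/-- A nonsingular Gaussian sequence has a linear model driven by white noise in which every state
is regressed on a set `pa k` of preceding states (in the order given by `ρ`) that separates it from
the other preceding states. -/
lemma IsZMNG.exists_model (hx : IsZMNG μ x) {ρ : Fin (N + 1) → ℕ} (hρ : Function.Injective ρ)
    {pa : Fin (N + 1) → Set (Fin (N + 1))} (hpa : ∀ k, ∀ j ∈ pa k, ρ j < ρ k)
    (hP : ∀ k i j, ρ k ≤ ρ i → ρ j < ρ k → j ∉ pa k → precision μ x i j = 0) :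
    ∃ (B : Fin (N + 1) → Fin (N + 1) → Matrix (Fin d) (Fin d) ℝ)
      (Q : Fin (N + 1) → Matrix (Fin d) (Fin d) ℝ) (e : Fin (N + 1) → Ω → Fin d → ℝ),
      (∀ k j, j ∉ pa k → B k j = 0) ∧ IsWhiteGaussian μ e Q ∧
      ∀ k ω, x k ω = ∑ j, B k j *ᵥ x j ω + e k ω := by
  have hx' := hx.toIsZeroMeanGaussian
  choose A hA hAC using fun k => exists_regression hx.nonsingular {p | p.1 ∈ pa k}
  let B : Fin (N + 1) → Fin (N + 1) → Matrix (Fin d) (Fin d) ℝ := fun k j => block (A k) k j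
  set C := covMatrix μ x with hC
  let L : Matrix (Fin (N + 1) × Fin d) (Fin (N + 1) × Fin d) ℝ := 1 - ofBlocks B
  have hLrow : ∀ p q, L p q = (1 - A p.1) p q := fun p q => rfl
  have hself : ∀ k, k ∉ pa k := fun k hk => (hpa k k hk).false
  -- The parents of k separate k and all later times (in the order `ρ`) from the other predecessors,
  -- so the residual of x_k is uncorrelated with every predecessor.
  have hLC : ∀ p q, ρ q.1 < ρ p.1 → (L * C) p q = 0 := by
    intro p q hpq
    have hci := (hx.condIndepGiven_iff_precision (S := {i | ρ p.1 ≤ ρ i}) (K := pa p.1)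
      (T := {i | ρ i < ρ p.1 ∧ i ∉ pa p.1})
      (Set.disjoint_left.2 fun i hi hi' => ((hpa _ _ hi').trans_le hi).false)
      (Set.disjoint_left.2 fun i hi hi' => (hi'.1.trans_le hi).false)
      (Set.disjoint_left.2 fun i hi hi' => hi'.2 hi)
      (fun i => by
        by_cases h1 : ρ p.1 ≤ ρ i
        · exact .inl h1
        by_cases h2 : i ∈ pa p.1
        · exact .inr (.inl h2)
        · exact .inr (.inr ⟨not_le.1 h1, h2⟩))).2 fun i hi j hj => hP p.1 i j hi hj.1 hj.2
    let L' : Matrix Unit (Fin (N + 1) × Fin d) ℝ := Matrix.of fun _ => L p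
    have hK : ∀ i q, q.1 ∈ pa p.1 → (L' * C) i q = 0 := fun i q hq => hAC p.1 p q hq
    by_cases hq : q.1 ∈ pa p.1
    · exact hK () q hq
    · refine hx'.mul_covMatrix_eq_zero hci (L := L') (fun i r hrS hrK => ?_) hK () q ⟨hpq, hq⟩
      have : p ≠ r := by rintro rfl; exact hrS (le_refl (ρ p.1))
      change L p r = 0
      rw [hLrow, Matrix.sub_apply, Matrix.one_apply_ne this, hA p.1 p r hrK, sub_zero]
  -- The earlier residual combines x_l and its parents, all of which precede k.
  have hcov : ∀ k l, ρ l < ρ k → covFun μ (linearSeq L x) k l = 0 := by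
    intro k l hlk
    ext a b
    refine (hx'.cov_mulVec L L (k, a) (l, b)).trans (Finset.sum_eq_zero fun q _ => ?_)
    change (L * C) (k, a) q * L (l, b) q = 0
    by_cases hq : ρ q.1 < ρ k
    · rw [hLC (k, a) q hq, zero_mul]
    · have h1 : (l, b) ≠ q := by rintro rfl; exact hq hlk
      have h2 : q.1 ∉ pa l := fun h => hq ((hpa l _ h).trans hlk)
      rw [hLrow, Matrix.sub_apply, Matrix.one_apply_ne h1,
        hA l (l, b) q h2, sub_zero, mul_zero]
  refine ⟨B, fun k => covFun μ (linearSeq L x) k k, linearSeq L x, ?_, ?_, ?_⟩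
  · intro k j hj
    ext a b
    exact hA k (k, a) (j, b) hj
  · refine { hx'.linearSeq L with white := ?_, cov_eq := fun k => rfl, nonsingular := fun k => ?_ }
    · intro k l hkl
      rcases lt_or_gt_of_ne (hρ.ne hkl) with h | h
      · have := hcov l k h
        ext a b
        have h' := congrFun (congrFun this b) a
        simp only [covFun, Matrix.of_apply] at h' ⊢
        rw [covariance_comm, h']
        rfl
      · exact hcov k l h
    -- `M` restricts to the identity on the columns of time k, since k is not its own parent. So its
    -- rows are linearly independent and M C M' is positive definite.
    · let M : Matrix (Fin d) (Fin (N + 1) × Fin d) ℝ := L.submatrix (fun a => (k, a)) id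
      have hM : covFun μ (linearSeq L x) k k = M * C * Mᴴ := by
        ext a b
        exact hx'.cov_mulVec L L (k, a) (k, b)
      rw [hM]
      refine hx.nonsingular.mul_mul_conjTranspose_same fun v w hvw => ?_
      have hv : ∀ (v : Fin d → ℝ) (b : Fin d), (v ᵥ* M) (k, b) = v b := by
        intro v b
        simp [Matrix.vecMul, dotProduct, M, hLrow, hA k _ (k, b) (hself k), Matrix.one_apply]
      ext b
      rw [← hv v, ← hv w]
      exact congrFun hvw (k, b)
  · intro k ω
    ext a
    rw [Pi.add_apply, ← stack_mulVec_ofBlocks (x := x) B ω]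
    simp only [linearSeq, L, Matrix.sub_mulVec, Matrix.one_mulVec, Pi.sub_apply]
    rw [add_sub_cancel]
    rfl

/-- A nonsingular Gaussian reciprocal sequence is governed by a forward `CM_c` model. -/
lemma IsZMNG.exists_governedBy (hN : 2 ≤ N) (hx : IsZMNG μ x) {c : Fin (N + 1)}
    (hc : c = 0 ∨ c = Fin.last N) (b : BoundaryForm) (h : IsReciprocal μ x) :
    ∃ (G : Fin (N + 1) → Fin (N + 1) → Matrix (Fin d) (Fin d) ℝ)
      (Q : Fin (N + 1) → Matrix (Fin d) (Fin d) ℝ), GovernedBy μ c b x G Q := by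
  rw [hx.isReciprocal_iff] at h
  have h' : ∀ i j : Fin (N + 1), (j : ℕ) + 1 < i → ¬ ((j : ℕ) = 0 ∧ (i : ℕ) = N) →
      precision μ x i j = 0 := fun i j hij hne => by
    rw [← hx.precision_transpose, h j i hij hne, Matrix.transpose_zero]
  -- For c = 0 this is the order of time. For c = N the two endpoints come first, in the order set
  -- by the boundary form, then the interior times, whose ranks start at 2.
  let ρ : Fin (N + 1) → ℕ := fun k => if c = 0 then k
    else if k = c then (match b with | .startFirst => 1 | .condFirst => 0)
    else if k = 0 then (match b with | .startFirst => 0 | .condFirst => 1)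
    else k + 1
  let pa : Fin (N + 1) → Set (Fin (N + 1)) := fun k => {j |
    (k ≠ 0 ∧ k ≠ c ∧ ((j : ℕ) + 1 = k ∨ j = c)) ∨
    (c ≠ 0 ∧ match b with | .startFirst => k = c ∧ j = 0 | .condFirst => k = 0 ∧ j = c)}
  have hN0 : Fin.last N ≠ 0 := by simp [Fin.ext_iff]; omega
  obtain ⟨B, Q, e, hB, he, hxe⟩ := hx.exists_model (ρ := ρ) (pa := pa)
    (by
      intro i j hij
      rcases hc with rfl | rfl <;> cases b <;>
        simp only [ρ, if_true, if_false, hN0, Fin.ext_iff, Fin.val_last, Fin.val_zero] at hij ⊢ <;>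
        (try split_ifs at hij) <;> omega)
    (by
      intro k j hj
      have hk := k.2
      rcases hc with rfl | rfl <;> cases b <;>
        simp only [ρ, pa, if_true, if_false, hN0, Fin.ext_iff, Fin.val_last, Fin.val_zero,
          Set.mem_ofPred_eq, ne_eq, not_true_eq_false, not_false_eq_true, true_and, false_and, or_false] at hj ⊢ <;>
        (try split_ifs) <;> omega)
    -- A predecessor j of k that is not a parent satisfies j + 1 < i for every i not preceding k,
    -- and (j, i) is not the corner.
    (by
      intro k i j hki hjk hj
      have hk := k.2
      have hi := i.2
      refine h' i j ?_ ?_ <;> rcases hc with rfl | rfl <;> cases b <;>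
        simp only [ρ, pa, if_true, if_false, hN0, Fin.ext_iff, Fin.val_last, Fin.val_zero,
          Set.mem_ofPred_eq, ne_eq, not_true_eq_false, not_false_eq_true, true_and, false_and, or_false] at hki hjk hj ⊢ <;>
        (try split_ifs at hki hjk) <;> omega)
  -- Halving compensates for the state x_0 appearing twice in the equation for x_1 when c = 0.
  refine ⟨fun k j => if k ≠ 0 ∧ k ≠ c ∧ (j : ℕ) + 1 = k ∧ j = c then (2⁻¹ : ℝ) • B k j else B k j, Q,
    (governedBy_iff (by omega) hc b _ Q).2 ⟨e, he, fun k => ae_of_all _ fun ω => ?_⟩⟩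
  rw [hxe k ω]
  congr 1
  refine Finset.sum_congr rfl fun j _ => ?_
  congr 1
  have hBkj := hB k j
  simp only [pa, Set.mem_ofPred_eq] at hBkj
  have hhalf : (2⁻¹ : ℝ) • B k j + (2⁻¹ : ℝ) • B k j = B k j := by
    rw [← add_smul]; norm_num
  unfold modelCoeff
  cases b <;> grind

end Existence

end GaussSeq

theorem mainTheorem3 {Ω : Type*} [MeasurableSpace Ω] (μ : Measure Ω) [IsProbabilityMeasure μ]
    (N d : ℕ) (hN : 2 ≤ N) (x : Fin (N + 1) → Ω → Fin d → ℝ) (hx : GaussSeq.IsZMNG μ x)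
    (c : Fin (N + 1)) (hc : c = 0 ∨ c = Fin.last N) :
    (∀ b : GaussSeq.BoundaryForm,
      (GaussSeq.IsReciprocal μ x ↔
        ∃ (G : Fin (N + 1) → Fin (N + 1) → Matrix (Fin d) (Fin d) ℝ)
          (Q : Fin (N + 1) → Matrix (Fin d) (Fin d) ℝ),
          GaussSeq.GovernedBy μ c b x G Q ∧ GaussSeq.ReciprocalCondition c G Q) ∧
      (GaussSeq.IsMarkov μ x ↔
        ∃ (G : Fin (N + 1) → Fin (N + 1) → Matrix (Fin d) (Fin d) ℝ)
          (Q : Fin (N + 1) → Matrix (Fin d) (Fin d) ℝ),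
          GaussSeq.GovernedBy μ c b x G Q ∧ GaussSeq.ReciprocalCondition c G Q ∧
            GaussSeq.MarkovCondition c b G Q) ∧
      (∀ (G : Fin (N + 1) → Fin (N + 1) → Matrix (Fin d) (Fin d) ℝ)
        (Q : Fin (N + 1) → Matrix (Fin d) (Fin d) ℝ),
        GaussSeq.GovernedBy μ c b x G Q →
          (GaussSeq.IsReciprocal μ x ↔ GaussSeq.ReciprocalCondition c G Q) ∧
          (GaussSeq.IsMarkov μ x ↔
            GaussSeq.ReciprocalCondition c G Q ∧ GaussSeq.MarkovCondition c b G Q))) ∧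
    (∀ (G G' : Fin (N + 1) → Fin (N + 1) → Matrix (Fin d) (Fin d) ℝ)
      (Q Q' : Fin (N + 1) → Matrix (Fin d) (Fin d) ℝ),
      GaussSeq.GovernedBy μ c .startFirst x G Q → GaussSeq.ReciprocalCondition c G Q →
      GaussSeq.GovernedBy μ c .condFirst x G' Q' → GaussSeq.ReciprocalCondition c G' Q' →
        (GaussSeq.MarkovCondition c .startFirst G Q ↔
          GaussSeq.MarkovCondition c .condFirst G' Q')) := by
  refine ⟨fun b => ⟨⟨fun h => ?_, ?_⟩, ⟨fun h => ?_, ?_⟩, fun G Q hG =>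
    ⟨hG.isReciprocal_iff hN hx hc, hG.isMarkov_iff hN hx hc⟩⟩, ?_⟩
  · obtain ⟨G, Q, hG⟩ := hx.exists_governedBy hN hc b h
    exact ⟨G, Q, hG, (hG.isReciprocal_iff hN hx hc).1 h⟩
  · rintro ⟨G, Q, hG, hR⟩
    exact (hG.isReciprocal_iff hN hx hc).2 hR
  · obtain ⟨G, Q, hG⟩ := hx.exists_governedBy hN hc b
      (hx.isReciprocal_iff.2 fun i j hij _ => hx.isMarkov_iff.1 h i j hij)
    exact ⟨G, Q, hG, (hG.isMarkov_iff hN hx hc).1 h⟩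
  · rintro ⟨G, Q, hG, hR⟩
    exact (hG.isMarkov_iff hN hx hc).2 hR
  · intro G G' Q Q' hG _ hG' _
    rw [← hG.precision_zero_last_eq_zero_iff hN hx hc,
      hG'.precision_zero_last_eq_zero_iff hN hx hc]
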